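/- Coordinator model. There are $s\ge 1$ servers; server $j$ holds a vector $x(j)\in\mathbb{R}_{\ge 0}^n$, $n\ge1$, and the coordinator has no input. All parties have access to a shared source of randomness. In a two-round protocol, each server sends a message (a bit string) to the coordinator, depending on its input and on the shared randomness; the coordinator then sends a possibly different message to each server, depending on the messages received and the shared randomness; each server sends a second message to the coordinator, depending on its input, on the message it received and on the shared randomness; finally the coordinator computes an output from the messages received and the shared randomness. The communication of the protocol is the total number of bits of all these messages, in both directions and for the worst case of inputs and randomness. Corollary. Let $k>2$ be a real number. There are constants $C_k,c_k$, depending only on $k$, such that for all $s,n\ge 1$, $0<\varepsilon<1$ and $M\ge 1$ there is a randomized two-round protocol in the coordinator model with $s$ servers that uses at most $$C_k\cdot \frac{s^{k-1}}{\varepsilon^2}\cdot \log^{c_k}\!\Big(2+\frac{n\,s\,M}{\varepsilon}\Big)$$ bits of communication and that, for all vectors $x(1),\dots,x(s)\in\mathbb{R}_{\ge 0}^n$ whose non-zero entries all lie in $[1/M,M]$, outputs with probability at least $9/10$ a number in $[(1-\varepsilon)F_k,(1+\varepsilon)F_k]$, where $F_k=\sum_{i=1}^n\big(\sum_{j=1}^s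 x_i(j)\big)^k$. -/

import Mathlib

open MeasureTheory

/-- A string of `b` bits. -/
abbrev BitString (b : ℕ) : Type := Fin b → Bool

/-- A randomized two-round protocol in the coordinator model with `s` servers, each of which
holds an input from `X`; the coordinator holds no input. All parties see the same sample `ω` of a
shared source of randomness, which is independent of the inputs.

* Round 1: server `j` sends `up₁ j ω (input of j)` to the coordinator, which replies to each
  server `j` with its own message `down j ω (all round-1 messages)`.
* Round 2: server `j` sends `up₂ j ω (input of j) (message received from the coordinator)` to the
  coordinator, which computes the output from `ω` and the messages of both rounds.

The message on each channel in each round has a fixed number of bits. -/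
structure TwoRoundProtocol (s : ℕ) (X : Type) where
  /-- the sample space of the shared randomness -/
  Ω : Type
  [mΩ : MeasurableSpace Ω]
  /-- the law of the shared randomness -/
  μ : Measure Ω
  [isProb : IsProbabilityMeasure μ]
  /-- number of bits that each server sends in round 1 -/
  upLen₁ : Fin s → ℕ
  /-- number of bits that the coordinator sends to each server between the two rounds -/
  downLen : Fin s → ℕ
  /-- number of bits that each server sends in round 2 -/
  upLen₂ : Fin s → ℕ
  up₁ : (j : Fin s) → Ω → X → BitString (upLen₁ j)
  down : (j : Fin s) → Ω → ((i : Fin s) → BitString (upLen₁ i)) → BitString (downLen j)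
  up₂ : (j : Fin s) → Ω → X → BitString (downLen j) → BitString (upLen₂ j)
  out : Ω → ((i : Fin s) → BitString (upLen₁ i)) → ((i : Fin s) → BitString (upLen₂ i)) → ℝ
  up₁_meas : ∀ j x, Measurable fun ω => up₁ j ω x
  down_meas : ∀ j m, Measurable fun ω => down j ω m
  up₂_meas : ∀ j x d, Measurable fun ω => up₂ j ω x d
  out_meas : ∀ m₁ m₂, Measurable fun ω => out ω m₁ m₂

namespace TwoRoundProtocol

attribute [instance] TwoRoundProtocol.mΩ TwoRoundProtocol.isProb

variable {s : ℕ} {X : Type} (P : TwoRoundProtocol s X)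

/-- The messages that the coordinator receives in round 1, when server `j` holds `x j`. -/
def msgs₁ (x : Fin s → X) (ω : P.Ω) (j : Fin s) : BitString (P.upLen₁ j) :=
  P.up₁ j ω (x j)

/-- The messages that the coordinator receives in round 2. -/
def msgs₂ (x : Fin s → X) (ω : P.Ω) (j : Fin s) : BitString (P.upLen₂ j) :=
  P.up₂ j ω (x j) (P.down j ω (P.msgs₁ x ω))

/-- The output of the coordinator. -/
def run (x : Fin s → X) (ω : P.Ω) : ℝ :=
  P.out ω (P.msgs₁ x ω) (P.msgs₂ x ω)

/-- The total number of bits communicated, over both rounds and in both directions. -/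
def totalBits : ℕ :=
  ∑ j, (P.upLen₁ j + P.downLen j + P.upLen₂ j)

end TwoRoundProtocol

/-- The `k`-th moment `∑ i, (∑ j, x_i(j)) ^ k` of the sum of the vectors held by the servers. -/
noncomputable def frequencyMoment {s n : ℕ} (k : ℝ) (x : Fin s → Fin n → ℝ) : ℝ :=
  ∑ i, (∑ j, x j i) ^ k

open scoped BigOperators

/-! After rounding to integers `a j i`, server `j` raises its entries to the power `k / 2`. The
column sums `v i` of these powers satisfy `(v i)² ≤ 4 w i` and `w i ≤ s^(k-2) (v i)²`, where `w i`
is the `k`-th power of the `i`-th column sum of `a` (`ceilPow_sq_le_rpow_sum`,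
`rpow_sum_le_mul_ceilPow_sq`). So `(v i)²` is a proxy for `w i`: including `i` with probability
about `min 1 ((v i)² / T²)`, for `T²` about `∑ (v i)² / N` and `N` of order `s^(k-2) / ε²`, gives a
Horvitz–Thompson estimate with relative error `O(ε)`.

The vector `v` is spread additively over the servers, so only linear sketches of it are cheap.
Sampling is therefore turned into a search for heavy entries: shared randomness multiplies `v i` by
a factor exceeding `t` with probability about `1 / t²`, and `i` is sampled when the product reaches
`T`. Scaling raises the squared norm only by a logarithmic factor, so about `N` entries up to
logarithms can be large, and a random sign sketch of that many rows finds them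
(`unifProb_heavyCandidates`). A second sketch, of constant size, estimates the norm and hence `T`.

Both sketches fit in round 1. The coordinator sends back a list of candidates and learns their exact
columns in round 2; it then decides membership in the sample exactly, so false candidates do no
harm. -/

/-- The probability of an event under the uniform distribution on a finite type. -/
noncomputable def unifProb {Ω : Type*} [Fintype Ω] (p : Ω → Prop) : ℝ :=
  𝔼 ω, {ω | p ω}.indicator (fun _ => (1 : ℝ)) ω

/-! ### Finite uniform probability, product spaces and second moments. -/

section UniformProbability

variable {Ω α β ι κ : Type*} [Fintype Ω] [Fintype α] [Fintype β] [Fintype ι] [Fintype κ]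

theorem unifProb_nonneg (p : Ω → Prop) : 0 ≤ unifProb p :=
  Finset.expect_nonneg fun _ _ => Set.indicator_nonneg (fun _ _ => zero_le_one) _

theorem unifProb_mono {p q : Ω → Prop} (h : ∀ ω, p ω → q ω) : unifProb p ≤ unifProb q :=
  Finset.expect_le_expect fun _ _ =>
    Set.indicator_le_indicator_of_subset (fun ω hω => h ω hω) (fun _ => zero_le_one) _

theorem unifProb_or_le (p q : Ω → Prop) :
    unifProb (fun ω => p ω ∨ q ω) ≤ unifProb p + unifProb q := by
  unfold unifProb
  rw [← Finset.expect_add_distrib]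
  refine Finset.expect_le_expect fun ω _ => ?_
  by_cases hp : p ω <;> by_cases hq : q ω <;> simp [Set.indicator, hp, hq]

theorem unifProb_exists_le (p : ι → Ω → Prop) :
    unifProb (fun ω => ∃ i, p i ω) ≤ ∑ i, unifProb (p i) := by
  unfold unifProb
  rw [← Finset.expect_sum_comm]
  refine Finset.expect_le_expect fun ω _ => ?_
  by_cases h : ∃ i, p i ω
  · obtain ⟨i, hi⟩ := h
    have : ({ω | p i ω}.indicator (fun _ => (1 : ℝ)) ω) = 1 := by simp [hi]
    refine le_trans (Set.indicator_le_self' (fun _ _ => zero_le_one) _) ?_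
    refine this.symm.le.trans ?_
    exact Finset.single_le_sum (f := fun i => {ω | p i ω}.indicator (fun _ => (1 : ℝ)) ω)
      (fun _ _ => Set.indicator_nonneg (fun _ _ => zero_le_one) _) (Finset.mem_univ i)
  · rw [Set.indicator_of_notMem (by simpa using h)]
    exact Finset.sum_nonneg fun _ _ => Set.indicator_nonneg (fun _ _ => zero_le_one) _

theorem unifProb_not [Nonempty Ω] (p : Ω → Prop) :
    unifProb (fun ω => ¬ p ω) = 1 - unifProb p := by
  have h : unifProb p + unifProb (fun ω => ¬ p ω) = 1 := by
    unfold unifProb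
    rw [← Finset.expect_add_distrib]
    rw [← Fintype.expect_const (ι := Ω) (1 : ℝ)]
    refine Finset.expect_congr rfl fun ω _ => ?_
    by_cases hp : p ω <;> simp [hp]
  linarith

theorem unifProb_le_one [Nonempty Ω] (p : Ω → Prop) : unifProb p ≤ 1 := by
  have := unifProb_not p
  have := unifProb_nonneg fun ω => ¬ p ω
  linarith

/-- Markov's inequality. -/
theorem unifProb_le_expect_div {f : Ω → ℝ} {t : ℝ} (hf : ∀ ω, 0 ≤ f ω) (ht : 0 < t) :
    unifProb (fun ω => t ≤ f ω) ≤ (𝔼 ω, f ω) / t := by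
  rw [le_div_iff₀ ht]
  unfold unifProb
  rw [Finset.expect_mul]
  refine Finset.expect_le_expect fun ω _ => ?_
  by_cases h : t ≤ f ω <;> simp [h, hf ω]

theorem expect_prod_type (f : α × β → ℝ) : 𝔼 x, f x = 𝔼 a, 𝔼 b, f (a, b) := by
  rw [← Finset.univ_product_univ, Finset.expect_product]

/-- A union bound in two stages. -/
theorem unifProb_prod_le [Nonempty α] [Nonempty β] {p : α × β → Prop} {good : α → Prop} {δ : ℝ}
    (hδ : 0 ≤ δ) (h : ∀ a, good a → unifProb (fun b => p (a, b)) ≤ δ) :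
    unifProb p ≤ unifProb (fun a => ¬ good a) + δ := by
  have h1 : unifProb p = 𝔼 a, unifProb fun b => p (a, b) := by
    unfold unifProb
    rw [expect_prod_type]
    rfl
  rw [h1, ← Fintype.expect_const (ι := α) δ]
  unfold unifProb
  rw [← Finset.expect_add_distrib]
  refine Finset.expect_le_expect fun a _ => ?_
  by_cases ha : good a
  · have := h a ha
    unfold unifProb at this
    simpa [ha] using this
  · have := unifProb_le_one fun b => p (a, b)
    unfold unifProb at this
    simp only [Set.mem_ofPred_eq, ha, not_false_eq_true, Set.indicator_of_mem]
    linarith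

theorem expect_pi_prod [DecidableEq ι] (f : ι → κ → ℝ) :
    𝔼 ω : ι → κ, ∏ i, f i (ω i) = ∏ i, 𝔼 x, f i x := by
  simp only [Fintype.expect_eq_sum_div_card]
  rw [Finset.prod_div_distrib, Finset.prod_univ_sum]
  simp [Fintype.piFinset_univ]

theorem expect_pi_apply [DecidableEq ι] [Nonempty κ] (i : ι) (h : κ → ℝ) :
    𝔼 ω : ι → κ, h (ω i) = 𝔼 x, h x := by
  have := expect_pi_prod (fun j x => if j = i then h x else 1 : ι → κ → ℝ)
  rw [Finset.prod_eq_single i (fun j _ hj => by simp [hj]) (by simp)] at this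
  simp only [if_true] at this
  rw [← this]
  refine Finset.expect_congr rfl fun ω _ => ?_
  rw [Finset.prod_eq_single i (fun j _ hj => by simp [hj]) (by simp)]
  simp

theorem expect_pi_mul [DecidableEq ι] [Nonempty κ] {i j : ι} (hij : i ≠ j) (g h : κ → ℝ) :
    𝔼 ω : ι → κ, g (ω i) * h (ω j) = (𝔼 x, g x) * 𝔼 x, h x := by
  have key : ∀ G H : ℝ, ∏ l, (if l = i then G else if l = j then H else 1) = G * H := by
    intro G H
    rw [Finset.prod_eq_mul i j hij (fun l _ hl => by simp [hl.1, hl.2]) (by simp) (by simp)]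
    simp [hij.symm]
  have := expect_pi_prod (fun l x => if l = i then g x else if l = j then h x else 1 : ι → κ → ℝ)
  rw [← key, ← Finset.expect_congr rfl fun ω _ => key (g (ω i)) (h (ω j))]
  have h1 : ∀ l, (𝔼 x, if l = i then g x else if l = j then h x else 1) =
      if l = i then 𝔼 x, g x else if l = j then 𝔼 x, h x else 1 := fun l => by
    split_ifs <;> simp
  simp_rw [h1] at this
  rw [← this]
  refine Finset.expect_congr rfl fun ω _ => Finset.prod_congr rfl fun l _ => ?_
  by_cases h1 : l = i
  · simp [h1]
  · by_cases h2 : l = j <;> simp [h1, h2, hij.symm]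

/-- The second moment of a sum of independent centred random variables. -/
theorem expect_sum_sq [DecidableEq ι] [Nonempty κ] (h : ι → κ → ℝ) (h0 : ∀ i, 𝔼 x, h i x = 0) :
    𝔼 ω : ι → κ, (∑ i, h i (ω i)) ^ 2 = ∑ i, 𝔼 x, h i x ^ 2 := by
  have h1 : ∀ ω : ι → κ, (∑ i, h i (ω i)) ^ 2 = ∑ i, ∑ j, h i (ω i) * h j (ω j) := fun ω => by
    rw [sq, Finset.sum_mul_sum]
  simp_rw [h1]
  rw [Finset.expect_sum_comm]
  refine Finset.sum_congr rfl fun i _ => ?_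
  rw [Finset.expect_sum_comm, Finset.sum_eq_single i]
  · rw [← expect_pi_apply i fun x => h i x ^ 2]
    exact Finset.expect_congr rfl fun ω _ => (sq _).symm
  · intro j _ hj
    rw [expect_pi_mul hj.symm, h0, zero_mul]
  · simp

end UniformProbability

/-! ### Random signs: norm estimation and recovery of coordinates. -/

/-- The sign `±1` encoded by a boolean. -/
def boolSign (b : Bool) : ℤ := if b then 1 else -1

section Signs

variable {ι ρ : Type*} [Fintype ι] [DecidableEq ι] [Fintype ρ] [DecidableEq ρ]

theorem boolSign_mul_self (b : Bool) : boolSign b * boolSign b = 1 := by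
  cases b <;> rfl

theorem abs_boolSign (b : Bool) : |boolSign b| = 1 := by
  cases b <;> rfl

theorem expect_bool (f : Bool → ℝ) : 𝔼 b, f b = (f true + f false) / 2 := by
  rw [Fintype.expect_eq_sum_div_card]
  simp

/-- Independence factors the expectation into `cosh (t * z i)`, and `cosh x ≤ exp (x² / 2)`. -/
theorem expect_exp_sign_sum (z : ι → ℝ) (t : ℝ) :
    𝔼 σ : ι → Bool, Real.exp (t * ∑ i, boolSign (σ i) * z i) ≤
      Real.exp (t ^ 2 * (∑ i, z i ^ 2) / 2) := by
  have h1 : ∀ σ : ι → Bool, Real.exp (t * ∑ i, boolSign (σ i) * z i) =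
      ∏ i, Real.exp (t * (boolSign (σ i) * z i)) := fun σ => by
    rw [Finset.mul_sum, Real.exp_sum]
  simp_rw [h1]
  rw [expect_pi_prod (fun i b => Real.exp (t * (boolSign b * z i)))]
  have h2 : Real.exp (t ^ 2 * (∑ i, z i ^ 2) / 2) = ∏ i, Real.exp ((t * z i) ^ 2 / 2) := by
    rw [← Real.exp_sum, Finset.mul_sum, Finset.sum_div]
    simp_rw [mul_pow]
  rw [h2]
  refine Finset.prod_le_prod (fun i _ => Finset.expect_nonneg fun _ _ => (Real.exp_pos _).le)
    fun i _ => ?_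
  rw [expect_bool]
  refine le_trans (le_of_eq ?_) (Real.cosh_le_exp_half_sq (t * z i))
  rw [Real.cosh_eq]
  simp [boolSign]

theorem expect_sign_sum_sq (z : ι → ℝ) :
    𝔼 σ : ι → Bool, (∑ i, boolSign (σ i) * z i) ^ 2 = ∑ i, z i ^ 2 := by
  rw [expect_sum_sq (fun i b => (boolSign b : ℝ) * z i)]
  · exact Finset.sum_congr rfl fun i _ => by rw [expect_bool]; simp [boolSign]
  · intro i
    rw [expect_bool]
    simp [boolSign]

theorem expect_sign_sum_pow_four_le (z : ι → ℝ) :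
    𝔼 σ : ι → Bool, (∑ i, boolSign (σ i) * z i) ^ 4 ≤ 96 * (∑ i, z i ^ 2) ^ 2 := by
  set W := ∑ i, z i ^ 2 with hW
  have hW0 : 0 ≤ W := Finset.sum_nonneg fun _ _ => sq_nonneg _
  rcases hW0.eq_or_lt with h | hpos
  · have hz : ∀ i, z i = 0 := fun i => by
      have := (Finset.sum_eq_zero_iff_of_nonneg fun i _ => sq_nonneg (z i)).1 h.symm i
        (Finset.mem_univ i)
      simpa using this
    simp [hz, sq_nonneg]
  have hs : 0 < √W := Real.sqrt_pos.2 hpos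
  have hsq : √W ^ 2 = W := Real.sq_sqrt hW0
  -- The quartic term of the exponential series gives `x⁴ / 24 ≤ exp |x|`. At the scale `x = y / √W`
  -- each exponential has mean at most `exp (1/2) ≤ 2`, whence `96 = 24 * (2 + 2)`.
  have hp : ∀ y : ℝ, y ^ 4 ≤ 24 * W ^ 2 * (Real.exp ((√W)⁻¹ * y) + Real.exp (-(√W)⁻¹ * y)) := by
    intro y
    have h1 : ((√W)⁻¹ * y) ^ 4 / 24 ≤ Real.exp ((√W)⁻¹ * y) + Real.exp (-(√W)⁻¹ * y) := by
      have h2 := Real.pow_div_factorial_le_exp |(√W)⁻¹ * y| (abs_nonneg _) 4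
      have h3 := Real.exp_abs_le ((√W)⁻¹ * y)
      have h4 : |(√W)⁻¹ * y| ^ 4 = ((√W)⁻¹ * y) ^ 4 := Even.pow_abs (by decide) _
      have h6 : ((Nat.factorial 4 : ℕ) : ℝ) = 24 := by norm_num [Nat.factorial]
      rw [h4, h6] at h2
      rw [neg_mul]
      linarith
    have h5 : y ^ 4 = 24 * W ^ 2 * (((√W)⁻¹ * y) ^ 4 / 24) := by
      have : W ^ 2 = √W ^ 4 := by rw [← hsq]; ring_nf; rw [Real.sqrt_sq hs.le]
      rw [this]
      field_simp
    rw [h5]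
    gcongr
  calc 𝔼 σ : ι → Bool, (∑ i, boolSign (σ i) * z i) ^ 4
      ≤ 𝔼 σ : ι → Bool, 24 * W ^ 2 * (Real.exp ((√W)⁻¹ * ∑ i, boolSign (σ i) * z i) +
          Real.exp (-(√W)⁻¹ * ∑ i, boolSign (σ i) * z i)) :=
        Finset.expect_le_expect fun σ _ => hp _
    _ ≤ 24 * W ^ 2 * (2 + 2) := by
        rw [← Finset.mul_expect, Finset.expect_add_distrib]
        have e1 : Real.exp (1 / 2) ≤ 2 := by
          have h := Real.exp_one_lt_d9
          have h2 : Real.exp (1 / 2) ^ 2 = Real.exp 1 := by rw [← Real.exp_nat_mul]; norm_num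
          nlinarith [Real.exp_pos (1 / 2)]
        have h6 := expect_exp_sign_sum z (√W)⁻¹
        have h7 := expect_exp_sign_sum z (-(√W)⁻¹)
        have h8 : ((√W)⁻¹) ^ 2 * W / 2 = 1 / 2 := by
          rw [inv_pow, hsq]; field_simp
        rw [neg_sq, ← hW, h8] at h7
        rw [← hW, h8] at h6
        gcongr <;> linarith
    _ = 96 * W ^ 2 := by ring

/-- The squared norm of `z` is estimated within a factor two by averaging squares of random
signed sums. -/
theorem unifProb_sign_sketch_norm (z : ι → ℝ) (hρ : 20000 ≤ Fintype.card ρ)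
    (hz : 0 < ∑ i, z i ^ 2) :
    unifProb (fun σ : ρ → ι → Bool =>
      ¬ ((∑ i, z i ^ 2) / 2 ≤ (∑ r, (∑ i, boolSign (σ r i) * z i) ^ 2) / Fintype.card ρ ∧
        (∑ r, (∑ i, boolSign (σ r i) * z i) ^ 2) / Fintype.card ρ ≤ 2 * ∑ i, z i ^ 2)) ≤
      1 / 50 := by
  set W := ∑ i, z i ^ 2 with hW
  set m : ℝ := (Fintype.card ρ : ℝ) with hm
  have hm0 : (20000 : ℝ) ≤ m := by rw [hm]; exact_mod_cast hρ
  have hvar : 𝔼 σ : ρ → ι → Bool, (∑ r, ((∑ i, boolSign (σ r i) * z i) ^ 2 - W)) ^ 2 ≤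
      m * (96 * W ^ 2) := by
    rw [expect_sum_sq (fun (_ : ρ) (s : ι → Bool) => (∑ i, boolSign (s i) * z i) ^ 2 - W)]
    · rw [hm, ← nsmul_eq_mul, ← Finset.card_univ]
      refine Finset.sum_le_card_nsmul _ _ _ fun r _ => ?_
      have h1 : ∀ s : ι → Bool, ((∑ i, boolSign (s i) * z i) ^ 2 - W) ^ 2 =
          (∑ i, boolSign (s i) * z i) ^ 4 - 2 * W * (∑ i, boolSign (s i) * z i) ^ 2 + W ^ 2 :=
        fun s => by ring
      simp_rw [h1]
      rw [Finset.expect_add_distrib, Finset.expect_sub_distrib, ← Finset.mul_expect,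
        expect_sign_sum_sq, Fintype.expect_const]
      have := expect_sign_sum_pow_four_le z
      rw [← hW] at this ⊢
      nlinarith
    · intro _
      rw [Finset.expect_sub_distrib, expect_sign_sum_sq, Fintype.expect_const, sub_self]
  -- Chebyshev at deviation `m * W / 2`: the failure probability is at most `384 / m`, below `1 /
  -- 50` for `m ≥ 20000`.
  have ht : 0 < (m * W / 2) ^ 2 := by positivity
  refine le_trans (unifProb_mono (q := fun σ : ρ → ι → Bool =>
    (m * W / 2) ^ 2 ≤ (∑ r, ((∑ i, boolSign (σ r i) * z i) ^ 2 - W)) ^ 2) ?_) <|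
    (unifProb_le_expect_div (fun _ => sq_nonneg _) ht).trans ?_
  · intro σ hσ
    by_contra hlt
    apply hσ
    have h2 := abs_lt_of_sq_lt_sq (not_le.1 hlt) (by positivity)
    rw [Finset.sum_sub_distrib, Finset.sum_const, Finset.card_univ, nsmul_eq_mul, ← hm,
      abs_lt] at h2
    have hmp : 0 < m := by linarith
    rw [le_div_iff₀ hmp, div_le_iff₀ hmp]
    constructor <;> nlinarith
  · rw [div_le_iff₀ ht]
    refine hvar.trans ?_
    have : 0 ≤ m * W ^ 2 * (m - 20000) := by
      apply mul_nonneg <;> [positivity; linarith]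
    nlinarith

/-- Multiplying all other signs by the sign at `i`. -/
def signFlip (i : ι) : Equiv.Perm (ι → Bool) :=
  Function.Involutive.toPerm (fun σ l => if l = i then σ i else σ l ^^ !σ i) fun σ => by
    funext l
    by_cases h : l = i
    · simp [h]
    · simp [h]

/-- Multiplying by the sign at `i` isolates `z i`; the remaining products of two signs are again
independent uniform signs, because `signFlip` permutes the sign patterns. The error is thus a random
signed sum of the other coordinates. -/
theorem expect_exp_sign_error (z : ι → ℝ) (i : ι) (t : ℝ) :
    𝔼 σ : ι → Bool, Real.exp (t * (boolSign (σ i) * (∑ l, boolSign (σ l) * z l) - z i)) ≤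
      Real.exp (t ^ 2 * (∑ l, z l ^ 2) / 2) := by
  have h1 : ∀ σ : ι → Bool, boolSign (σ i) * (∑ l, boolSign (σ l) * z l) - z i =
      ∑ l, boolSign (signFlip i σ l) * Function.update z i 0 l := fun σ => by
    rw [← Finset.add_sum_erase _ _ (Finset.mem_univ i), mul_add, ← mul_assoc, ← Int.cast_mul,
      boolSign_mul_self, ← Finset.add_sum_erase (s := Finset.univ)
        (fun l => (boolSign (signFlip i σ l) : ℝ) * Function.update z i 0 l) (Finset.mem_univ i),
      Finset.mul_sum]
    simp only [Function.update_self, mul_zero, zero_add, Int.cast_one, one_mul, add_sub_cancel_left]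
    refine Finset.sum_congr rfl fun l hl => ?_
    have hl' : l ≠ i := Finset.ne_of_mem_erase hl
    rw [Function.update_of_ne hl', ← mul_assoc, ← Int.cast_mul]
    congr 2
    have : signFlip i σ l = (σ l ^^ !σ i) := by
      simp [signFlip, Function.Involutive.toPerm, hl']
    rw [this]
    cases σ l <;> cases σ i <;> rfl
  simp_rw [h1]
  have h2 : 𝔼 σ : ι → Bool, Real.exp (t * ∑ l, boolSign (signFlip i σ l) *
      Function.update z i 0 l) =
      𝔼 σ : ι → Bool, Real.exp (t * ∑ l, boolSign (σ l) * Function.update z i 0 l) :=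
    Fintype.expect_equiv (signFlip i) _ _ fun _ => rfl
  rw [h2]
  refine (expect_exp_sign_sum _ t).trans ?_
  gcongr Real.exp (t ^ 2 * ?_ / 2)
  refine Finset.sum_le_sum fun l _ => ?_
  by_cases hl : l = i
  · subst hl
    simp [sq_nonneg]
  · simp [hl]

/-- The estimate of the coordinate `z i` from signed sums with sign patterns `σ r`. -/
noncomputable def signEstimate (σ : ρ → ι → Bool) (y : ρ → ℝ) (i : ι) : ℝ :=
  (∑ r, boolSign (σ r i) * y r) / Fintype.card ρ

/-- Chernoff's bound over the independent rows, with the optimal exponent `t / V`. -/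
theorem unifProb_signEstimate_sub_ge [Nonempty ρ] (z : ι → ℝ) (i : ι) {t V : ℝ} (ht : 0 < t)
    (hV : 0 < V) (hz : ∑ l, z l ^ 2 ≤ V) :
    unifProb (fun σ : ρ → ι → Bool =>
      t ≤ signEstimate σ (fun r => ∑ l, boolSign (σ r l) * z l) i - z i) ≤
      Real.exp (-(Fintype.card ρ * t ^ 2 / (2 * V))) := by
  set m : ℝ := (Fintype.card ρ : ℝ) with hm
  have hmp : 0 < m := by rw [hm]; exact_mod_cast Fintype.card_pos
  let e : (ι → Bool) → ℝ := fun s => boolSign (s i) * (∑ l, boolSign (s l) * z l) - z i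
  have he : ∀ σ : ρ → ι → Bool, signEstimate σ (fun r => ∑ l, boolSign (σ r l) * z l) i - z i =
      (∑ r, e (σ r)) / m := fun σ => by
    simp only [signEstimate, e, ← hm]
    rw [Finset.sum_sub_distrib, Finset.sum_const, Finset.card_univ, nsmul_eq_mul, ← hm]
    field_simp
  have hmgf : 𝔼 σ : ρ → ι → Bool, Real.exp (t / V * ∑ r, e (σ r)) ≤
      Real.exp (m * (t ^ 2 / (2 * V))) := by
    simp_rw [Finset.mul_sum, Real.exp_sum]
    rw [expect_pi_prod (fun _ s => Real.exp (t / V * e s)), Finset.prod_const, Finset.card_univ,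
      hm, Real.exp_nat_mul]
    refine pow_le_pow_left₀ (Finset.expect_nonneg fun _ _ => (Real.exp_pos _).le) ?_ _
    refine (expect_exp_sign_error z i _).trans (Real.exp_le_exp.2 ?_)
    calc (t / V) ^ 2 * (∑ l, z l ^ 2) / 2 ≤ (t / V) ^ 2 * V / 2 := by gcongr
      _ = t ^ 2 / (2 * V) := by field_simp
  refine le_trans (unifProb_mono (q := fun σ : ρ → ι → Bool =>
    Real.exp (m * t ^ 2 / V) ≤ Real.exp (t / V * ∑ r, e (σ r))) ?_) <|
    (unifProb_le_expect_div (fun _ => (Real.exp_pos _).le) (Real.exp_pos _)).trans ?_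
  · intro σ hσ
    rw [he, le_div_iff₀ hmp] at hσ
    refine Real.exp_le_exp.2 ?_
    calc m * t ^ 2 / V = t / V * (t * m) := by ring
      _ ≤ _ := by gcongr
  · rw [div_le_iff₀ (Real.exp_pos _), ← Real.exp_add]
    refine hmgf.trans (Real.exp_le_exp.2 (le_of_eq ?_))
    field_simp
    ring

theorem unifProb_signEstimate_error [Nonempty ρ] (z : ι → ℝ) {t V : ℝ} (ht : 0 < t)
    (hV : 0 < V) (hz : ∑ l, z l ^ 2 ≤ V) :
    unifProb (fun σ : ρ → ι → Bool => ∃ i,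
      t ≤ |signEstimate σ (fun r => ∑ l, boolSign (σ r l) * z l) i - z i|) ≤
      2 * Fintype.card ι * Real.exp (-(Fintype.card ρ * t ^ 2 / (2 * V))) := by
  refine (unifProb_exists_le _).trans ?_
  have key : ∀ i, unifProb (fun σ : ρ → ι → Bool =>
      t ≤ |signEstimate σ (fun r => ∑ l, boolSign (σ r l) * z l) i - z i|) ≤
      2 * Real.exp (-(Fintype.card ρ * t ^ 2 / (2 * V))) := by
    intro i
    have h1 := unifProb_signEstimate_sub_ge (ρ := ρ) z i ht hV hz
    have h2 := unifProb_signEstimate_sub_ge (ρ := ρ) (fun l => - z l) i ht hV (by simpa using hz)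
    refine le_trans (unifProb_mono fun σ hσ => ?_) ((unifProb_or_le _ _).trans (add_le_add h1 h2))
      |>.trans (by linarith)
    rcases le_abs.1 hσ with h | h
    · exact Or.inl h
    · refine Or.inr (h.trans (le_of_eq ?_))
      simp only [signEstimate, mul_neg, Finset.sum_neg_distrib]
      ring
  refine (Finset.sum_le_card_nsmul _ _ _ fun i _ => key i).trans (le_of_eq ?_)
  rw [nsmul_eq_mul, Finset.card_univ]
  ring

end Signs

/-! ### Variance of the Horvitz–Thompson estimator. -/

section HorvitzThompson

variable {ι κ : Type*} [Fintype ι] [DecidableEq ι] [Fintype κ]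

/-- The Horvitz–Thompson estimator of `∑ i, w i`, when `i` is included in the sample exactly if
the event `E i` occurs. -/
noncomputable def horvitzThompson (E : ι → κ → Prop) (w : ι → ℝ) (ω : ι → κ) : ℝ :=
  ∑ i, {x | E i x}.indicator (fun _ => w i / unifProb (E i)) (ω i)

/-- By independence only the individual variances remain. The `-1` is kept because it makes the
terms of surely included coordinates vanish. -/
theorem expect_horvitzThompson_sub_sq_le [Nonempty κ] (E : ι → κ → Prop) (w : ι → ℝ)
    (hE : ∀ i, w i = 0 ∨ 0 < unifProb (E i)) :
    𝔼 ω : ι → κ, (horvitzThompson E w ω - ∑ i, w i) ^ 2 ≤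
      ∑ i, w i ^ 2 * (1 / unifProb (E i) - 1) := by
  unfold horvitzThompson
  simp_rw [← Finset.sum_sub_distrib]
  have hind : ∀ i (c : ℝ), 𝔼 x, {x | E i x}.indicator (fun _ => c) x = c * unifProb (E i) := by
    intro i c
    unfold unifProb
    rw [Finset.mul_expect]
    refine Finset.expect_congr rfl fun x _ => ?_
    by_cases hx : E i x <;> simp [hx]
  rw [expect_sum_sq (fun i x => {x | E i x}.indicator (fun _ => w i / unifProb (E i)) x - w i)]
  · refine Finset.sum_le_sum fun i _ => ?_
    have h1 : ∀ x, ({x | E i x}.indicator (fun _ => w i / unifProb (E i)) x - w i) ^ 2 =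
        {x | E i x}.indicator (fun _ => (w i / unifProb (E i)) ^ 2 -
          2 * w i * (w i / unifProb (E i))) x + w i ^ 2 := fun x => by
      by_cases hx : E i x <;> simp [hx]; ring
    simp_rw [h1]
    rw [Finset.expect_add_distrib, hind, Fintype.expect_const]
    rcases hE i with h | h
    · simp [h]
    · refine le_of_eq ?_
      field_simp
      ring
  · intro i
    rw [Finset.expect_sub_distrib, hind, Fintype.expect_const]
    rcases hE i with h | h
    · simp [h]
    · field_simp
      ring

end HorvitzThompson

/-! ### Heavy-tailed random scaling. -/

section Scale

variable {Q : ℕ}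

/-- A heavy-tailed scaling factor, exceeding `t` with probability about `1 / t ^ 2` when `u` is
uniform. -/
def tailScale (u : Fin Q) : ℕ := Nat.sqrt (Q / (u + 1))

theorem le_tailScale_iff {t : ℕ} (ht : 0 < t) (u : Fin Q) :
    t ≤ tailScale u ↔ (u : ℕ) < Q / t ^ 2 := by
  unfold tailScale
  rw [Nat.le_sqrt', Nat.le_div_iff_mul_le (Nat.succ_pos _), ← Nat.succ_le_iff,
    Nat.le_div_iff_mul_le (by positivity), mul_comm]

theorem tailScale_le (u : Fin Q) : tailScale u ≤ Q :=
  (Nat.sqrt_le_self _).trans (Nat.div_le_self _ _)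

/-- The square is at most `Q / (u + 1)`, so its mean is at most the harmonic number of `Q`.
Discretizing to `Q` values is what keeps this moment finite. -/
theorem expect_tailScale_sq_le (hQ : 0 < Q) :
    𝔼 u : Fin Q, (tailScale u : ℝ) ^ 2 ≤ 1 + Real.log Q := by
  refine le_trans ?_ (harmonic_le_one_add_log Q)
  rw [Fintype.expect_eq_sum_div_card, Fintype.card_fin, div_le_iff₀ (by exact_mod_cast hQ),
    harmonic, Rat.cast_sum, Finset.sum_mul, ← Fin.sum_univ_eq_sum_range
      (fun i => (((((i + 1 : ℕ) : ℚ)⁻¹ : ℚ) : ℝ) * Q))]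
  refine Finset.sum_le_sum fun u _ => ?_
  have h1 : tailScale u ^ 2 ≤ Q / (u + 1) := Nat.sqrt_le' _
  calc (tailScale u : ℝ) ^ 2 ≤ ((Q / ((u : ℕ) + 1) : ℕ) : ℝ) := by exact_mod_cast h1
    _ ≤ (Q : ℝ) / (((u : ℕ) + 1 : ℕ) : ℝ) := Nat.cast_div_le
    _ = _ := by push_cast; ring

theorem unifProb_le_tailScale {t : ℕ} (ht : 0 < t) :
    unifProb (fun u : Fin Q => t ≤ tailScale u) = ((Q / t ^ 2 : ℕ) : ℝ) / Q := by
  unfold unifProb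
  simp_rw [le_tailScale_iff ht]
  rw [Fintype.expect_eq_sum_div_card, Fintype.card_fin]
  congr 1
  simp only [Set.indicator, Set.mem_ofPred_eq, Finset.sum_boole]
  rw [Fin.card_filter_val_lt, min_eq_right (Nat.div_le_self _ _)]

theorem unifProb_le_tailScale_mul {v : ℕ} {T : ℝ} (hT : 0 < T) (hv : 0 < v)
    (hQ : (T / v + 1) ^ 2 ≤ Q) :
    0 < unifProb (fun u : Fin Q => T ≤ tailScale u * v) ∧
    1 / unifProb (fun u : Fin Q => T ≤ tailScale u * v) - 1 ≤ 8 * T ^ 2 / v ^ 2 := by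
  have hv' : (0 : ℝ) < v := by exact_mod_cast hv
  have hx : 0 < T / v := by positivity
  set x := T / v with hxd
  have hQ0 : 0 < Q := by
    have : (0 : ℝ) < Q := lt_of_lt_of_le (by positivity) hQ
    exact_mod_cast this
  have ht : 0 < ⌈x⌉₊ := Nat.ceil_pos.2 hx
  have h1 : (fun u : Fin Q => T ≤ tailScale u * v) = fun u => ⌈x⌉₊ ≤ tailScale u := by
    funext u
    rw [Nat.ceil_le, hxd, div_le_iff₀ hv']
  rw [h1, unifProb_le_tailScale ht]
  set t := ⌈x⌉₊
  have htx : (t : ℝ) < x + 1 := Nat.ceil_lt_add_one hx.le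
  have htQ : t ^ 2 ≤ Q := by
    have : (t : ℝ) ^ 2 ≤ Q := le_trans (by gcongr) hQ
    exact_mod_cast this
  have hpos : 0 < Q / t ^ 2 := Nat.div_pos htQ (by positivity)
  have hpos' : (0 : ℝ) < ((Q / t ^ 2 : ℕ) : ℝ) := by exact_mod_cast hpos
  have hQ' : (0 : ℝ) < Q := by exact_mod_cast hQ0
  refine ⟨by positivity, ?_⟩
  have hx2 : 8 * T ^ 2 / v ^ 2 = 8 * x ^ 2 := by rw [hxd]; ring
  rw [hx2, one_div_div]
  -- For `t > 1` one has `x > 1`, and the rounding in `Q / t ^ 2` loses at most a factor 2, so `1 /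
  -- p ≤ 2 t² ≤ 2 (x + 1)² ≤ 8 x²`. For `t = 1` inclusion is certain and the left side is zero.
  rcases Nat.lt_or_ge 1 t with h2 | h2
  · have hx1 : 1 < x := by
      have := Nat.lt_ceil.1 h2
      simpa using this
    have h3 : Q ≤ 2 * t ^ 2 * (Q / t ^ 2) := by
      have h4 := Nat.div_add_mod Q (t ^ 2)
      have h5 := Nat.mod_lt Q (show 0 < t ^ 2 by positivity)
      have h6 : t ^ 2 * 1 ≤ t ^ 2 * (Q / t ^ 2) := Nat.mul_le_mul_left _ hpos
      nlinarith
    have h3' : (Q : ℝ) ≤ 2 * t ^ 2 * ((Q / t ^ 2 : ℕ) : ℝ) := by exact_mod_cast h3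
    have h7 : (Q : ℝ) / ((Q / t ^ 2 : ℕ) : ℝ) ≤ 2 * t ^ 2 := by rwa [div_le_iff₀ hpos']
    have ht0 : (0 : ℝ) ≤ t := Nat.cast_nonneg _
    nlinarith
  · have : t = 1 := le_antisymm h2 ht
    rw [this]
    simp only [one_pow, Nat.div_one, div_self hQ'.ne', sub_self]
    positivity

end Scale

/-! ### From bounded integer messages to bit strings. -/

section Encoding

theorem exists_bitString_encoding {α : Type} [Fintype α] [Nonempty α] {b : ℕ}
    (h : Fintype.card α ≤ 2 ^ b) :
    ∃ (e : α → BitString b) (d : BitString b → α), ∀ a, d (e a) = a := by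
  have h1 : Fintype.card α ≤ Fintype.card (BitString b) := by simpa using h
  obtain ⟨e⟩ := Function.Embedding.nonempty_of_card_le h1
  exact ⟨e, Function.invFun e, Function.leftInverse_invFun e.injective⟩

theorem exists_int_vector_encoding (ι : Type) [Fintype ι] (b : ℕ) :
    ∃ (e : (ι → ℤ) → BitString ((b + 2) * Fintype.card ι))
      (d : BitString ((b + 2) * Fintype.card ι) → ι → ℤ),
      ∀ y, (∀ i, |y i| ≤ 2 ^ b) → d (e y) = y := by
  classical
  let I := ↥(Finset.Icc (-2 ^ b : ℤ) (2 ^ b))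
  have : Nonempty I := ⟨⟨0, by simp⟩⟩
  have hI : Fintype.card I ≤ 2 ^ (b + 2) := by
    have h1 : 1 ≤ 2 ^ b := Nat.one_le_two_pow
    have h2 : (((2 : ℤ) ^ b + 1 - -2 ^ b).toNat : ℤ) = 2 * 2 ^ b + 1 := by
      have : (0 : ℤ) < 2 ^ b := by positivity
      omega
    have h3 : ((2 : ℤ) ^ b + 1 - -2 ^ b).toNat = 2 * 2 ^ b + 1 := by exact_mod_cast h2
    rw [Fintype.card_coe, Int.card_Icc, h3, pow_add]
    omega
  have hcard : Fintype.card (ι → I) ≤ 2 ^ ((b + 2) * Fintype.card ι) := by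
    rw [Fintype.card_fun, pow_mul]
    exact Nat.pow_le_pow_left hI _
  obtain ⟨e, d, hed⟩ := exists_bitString_encoding hcard
  -- Entries out of range are sent as `0`; decoding is claimed only for vectors within the bound.
  refine ⟨fun y => e fun i => if h : y i ∈ Finset.Icc (-2 ^ b : ℤ) (2 ^ b) then ⟨y i, h⟩
    else ⟨0, by simp⟩, fun c i => d c i, fun y hy => ?_⟩
  funext i
  have := abs_le.1 (hy i)
  simp [hed, this.1, this.2]

/-- Two-round protocols may be described by messages that are vectors of bounded integers,
with a finite sample space. -/
theorem exists_twoRoundProtocol {s n b : ℕ} {X Ω ι₁ κ ι₂ : Type} [Fintype Ω] [Nonempty Ω]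
    [Fintype ι₁] [Fintype κ] [Fintype ι₂] (hn : 0 < n) (hnb : n ≤ 2 ^ b)
    (up₁ : Ω → X → ι₁ → ℤ) (down : Ω → (Fin s → ι₁ → ℤ) → κ → Fin n)
    (up₂ : Ω → X → (κ → Fin n) → ι₂ → ℤ)
    (out : Ω → (Fin s → ι₁ → ℤ) → (Fin s → ι₂ → ℤ) → ℝ)
    (h₁ : ∀ ω x i, |up₁ ω x i| ≤ 2 ^ b) (h₂ : ∀ ω x q i, |up₂ ω x q i| ≤ 2 ^ b) :
    ∃ P : TwoRoundProtocol s X,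
      P.totalBits = s * ((b + 2) * (Fintype.card ι₁ + Fintype.card κ + Fintype.card ι₂)) ∧
      ∀ (x : Fin s → X) (S : Set ℝ), P.μ.real {ω | P.run x ω ∈ S} =
        unifProb fun ω => out ω (fun j => up₁ ω (x j))
          (fun j => up₂ ω (x j) (down ω fun i => up₁ ω (x i))) ∈ S := by
  classical
  obtain ⟨e₁, d₁, hed₁⟩ := exists_int_vector_encoding ι₁ b
  obtain ⟨e₂, d₂, hed₂⟩ := exists_int_vector_encoding ι₂ b
  obtain ⟨e, d, hed⟩ : ∃ (e : (κ → Fin n) → BitString ((b + 2) * Fintype.card κ))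
      (d : BitString ((b + 2) * Fintype.card κ) → (κ → Fin n)), ∀ a, d (e a) = a := by
    have : Nonempty (κ → Fin n) := ⟨fun _ => ⟨0, hn⟩⟩
    refine exists_bitString_encoding ?_
    rw [Fintype.card_fun, Fintype.card_fin, pow_mul]
    exact Nat.pow_le_pow_left (hnb.trans (Nat.pow_le_pow_right two_pos (by omega))) _
  let : MeasurableSpace Ω := ⊤
  have : IsProbabilityMeasure (PMF.uniformOfFintype Ω).toMeasure := inferInstance
  let P : TwoRoundProtocol s X :=
    { Ω := Ω
      μ := (PMF.uniformOfFintype Ω).toMeasure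
      upLen₁ := fun _ => (b + 2) * Fintype.card ι₁
      downLen := fun _ => (b + 2) * Fintype.card κ
      upLen₂ := fun _ => (b + 2) * Fintype.card ι₂
      up₁ := fun _ ω x => e₁ (up₁ ω x)
      down := fun _ ω m => e (down ω fun i => d₁ (m i))
      up₂ := fun _ ω x m => e₂ (up₂ ω x (d m))
      out := fun ω m₁ m₂ => out ω (fun i => d₁ (m₁ i)) (fun i => d₂ (m₂ i))
      up₁_meas := fun _ _ => measurable_from_top
      down_meas := fun _ _ => measurable_from_top
      up₂_meas := fun _ _ _ => measurable_from_top
      out_meas := fun _ _ => measurable_from_top }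
  refine ⟨P, ?_, fun x S => ?_⟩
  · simp only [TwoRoundProtocol.totalBits, P]
    rw [Finset.sum_const, Finset.card_univ, Fintype.card_fin, smul_eq_mul]
    ring
  · have hrun : ∀ ω, P.run x ω = out ω (fun j => up₁ ω (x j))
        (fun j => up₂ ω (x j) (down ω fun i => up₁ ω (x i))) := fun ω => by
      simp only [TwoRoundProtocol.run, TwoRoundProtocol.msgs₁, TwoRoundProtocol.msgs₂, P, hed,
        hed₁ _ (h₁ _ _), hed₂ _ (h₂ _ _ _)]
    simp_rw [hrun]
    change ((PMF.uniformOfFintype Ω).toMeasure _).toReal = _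
    rw [PMF.toMeasure_uniformOfFintype_apply _ MeasurableSpace.measurableSet_top]
    unfold unifProb
    rw [Fintype.expect_eq_sum_div_card]
    simp only [Set.indicator, Set.mem_ofPred_eq, Finset.sum_boole, ENNReal.toReal_div,
      ENNReal.toReal_natCast]
    rw [Fintype.card_subtype]
    rfl

end Encoding

/-! ### Comparing the moment with squares of sums of local powers. -/

section Moments

theorem sum_rpow_le_rpow_sum {ι : Type*} (S : Finset ι) (f : ι → ℝ) (hf : ∀ i ∈ S, 0 ≤ f i)
    {p : ℝ} (hp : 1 ≤ p) : ∑ i ∈ S, f i ^ p ≤ (∑ i ∈ S, f i) ^ p := by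
  classical
  induction S using Finset.induction_on with
  | empty => simp [Real.zero_rpow (by linarith : p ≠ 0)]
  | insert i S hi ih =>
    rw [Finset.sum_insert hi, Finset.sum_insert hi]
    have h1 := ih fun j hj => hf j (Finset.mem_insert_of_mem hj)
    have h2 := hf i (Finset.mem_insert_self _ _)
    have h3 : 0 ≤ ∑ j ∈ S, f j :=
      Finset.sum_nonneg fun j hj => hf j (Finset.mem_insert_of_mem hj)
    exact (add_le_add_right h1 _).trans (Real.add_rpow_le_rpow_add h2 h3 hp)

/-- The `p`-th power of a natural number, rounded up to a natural number. -/
noncomputable def ceilPow (p : ℝ) (a : ℕ) : ℕ := ⌈(a : ℝ) ^ p⌉₊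

variable {p : ℝ}

theorem rpow_le_ceilPow (a : ℕ) : (a : ℝ) ^ p ≤ ceilPow p a := Nat.le_ceil _

theorem ceilPow_zero (hp : p ≠ 0) : ceilPow p 0 = 0 := by
  simp [ceilPow, Real.zero_rpow hp]

/-- A positive integer has a power at least 1, so rounding up at most doubles it, and zero stays
zero. -/
theorem ceilPow_le_two_mul (hp : 0 < p) (a : ℕ) : (ceilPow p a : ℝ) ≤ 2 * (a : ℝ) ^ p := by
  rcases Nat.eq_zero_or_pos a with rfl | ha
  · rw [ceilPow_zero hp.ne']
    simp [Real.zero_rpow hp.ne']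
  · have h1 : 1 ≤ (a : ℝ) ^ p := Real.one_le_rpow (by exact_mod_cast ha) hp.le
    have := (Nat.ceil_lt_add_one (zero_le_one.trans h1)).le
    unfold ceilPow
    linarith

theorem ceilPow_le_pow (hp : 0 < p) {a A c : ℕ} (ha : a ≤ A) (hA : 0 < A) (hc : p ≤ c) :
    ceilPow p a ≤ A ^ c := by
  refine Nat.ceil_le.2 ?_
  rw [Nat.cast_pow, ← Real.rpow_natCast]
  exact (Real.rpow_le_rpow (Nat.cast_nonneg _) (by exact_mod_cast ha) hp.le).trans
    (Real.rpow_le_rpow_of_exponent_le (by exact_mod_cast hA) hc)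

variable {s : ℕ} {k : ℝ}

/-- The power mean inequality with exponent `k / 2`, squared; this is the source of the factor
`s^(k-2)` in the sample size. -/
theorem rpow_sum_le_mul_ceilPow_sq (hk : 2 < k) (a : Fin s → ℕ) :
    (∑ j, (a j : ℝ)) ^ k ≤ (s : ℝ) ^ (k - 2) * (∑ j, (ceilPow (k / 2) (a j) : ℝ)) ^ 2 := by
  have h0 : (0 : ℝ) ≤ ∑ j, (a j : ℝ) := Finset.sum_nonneg fun _ _ => Nat.cast_nonneg _
  have h1 := Real.rpow_sum_le_const_mul_sum_rpow_of_nonneg (f := fun j => (a j : ℝ))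
    (s := Finset.univ) (p := k / 2) (by linarith) (fun _ _ => Nat.cast_nonneg _)
  rw [Finset.card_univ, Fintype.card_fin] at h1
  have h2 : (∑ j, (a j : ℝ)) ^ (k / 2) ≤
      (s : ℝ) ^ (k / 2 - 1) * ∑ j, (ceilPow (k / 2) (a j) : ℝ) :=
    h1.trans (by gcongr with j _; exact rpow_le_ceilPow _)
  have h3 := pow_le_pow_left₀ (by positivity) h2 2
  rw [mul_pow, ← Real.rpow_mul_natCast h0, ← Real.rpow_mul_natCast (Nat.cast_nonneg _)] at h3
  have e1 : k / 2 * (2 : ℕ) = k := by push_cast; ring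
  have e2 : (k / 2 - 1) * (2 : ℕ) = k - 2 := by push_cast; ring
  rwa [e1, e2] at h3

/-- Superadditivity of `x ↦ x^(k/2)`, squared; the factor 4 is the square of the rounding loss. -/
theorem ceilPow_sq_le_rpow_sum (hk : 2 < k) (a : Fin s → ℕ) :
    (∑ j, (ceilPow (k / 2) (a j) : ℝ)) ^ 2 ≤ 4 * (∑ j, (a j : ℝ)) ^ k := by
  have h0 : (0 : ℝ) ≤ ∑ j, (a j : ℝ) := Finset.sum_nonneg fun _ _ => Nat.cast_nonneg _
  have h1 : ∑ j, (ceilPow (k / 2) (a j) : ℝ) ≤ 2 * (∑ j, (a j : ℝ)) ^ (k / 2) := by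
    refine (Finset.sum_le_sum fun j _ => ceilPow_le_two_mul (by linarith) (a j)).trans ?_
    rw [← Finset.mul_sum]
    gcongr
    exact sum_rpow_le_rpow_sum _ _ (fun _ _ => Nat.cast_nonneg _) (by linarith)
  have h3 := pow_le_pow_left₀ (by positivity) h1 2
  rw [mul_pow, ← Real.rpow_mul_natCast h0] at h3
  have e1 : k / 2 * (2 : ℕ) = k := by push_cast; ring
  rw [e1] at h3
  linarith

end Moments

/-! ### Analysis of the sampling scheme. -/

section Analysis

variable {ι ρ₁ ρ₂ : Type*} [Fintype ι] [DecidableEq ι] [Fintype ρ₁] [DecidableEq ρ₁]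
  [Fintype ρ₂] [DecidableEq ρ₂] {Q : ℕ}

/-- Chebyshev: the variance is at most `8 T² B ∑ w`, and `T² ≤ 8 ∑ w / N` makes this at most `64 B
(∑ w)² / N`. The constant 51200 is `64 * 16 * 50`. -/
theorem unifProb_horvitzThompson_error {v : ι → ℕ} {w : ι → ℝ} {B N ε T : ℝ} (hw : ∀ i, 0 ≤ w i)
    (hB : 0 < B) (hwv : ∀ i, w i ≤ B * (v i : ℝ) ^ 2) (hvw : ∀ i, (v i : ℝ) ^ 2 ≤ 4 * w i)
    (hε : 0 < ε) (hN : 51200 * B / ε ^ 2 ≤ N) (hv : 0 < ∑ i, (v i : ℝ) ^ 2) (hT : 0 < T)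
    (hTW : T ^ 2 ≤ 2 * (∑ i, (v i : ℝ) ^ 2) / N) (hQ : 2 * T ^ 2 + 2 ≤ Q) :
    unifProb (fun g : ι → Fin Q => ε / 4 * ∑ i, w i ≤
      |horvitzThompson (fun i u => T ≤ tailScale u * v i) w g - ∑ i, w i|) ≤ 1 / 50 := by
  have hQ0 : 0 < Q := by
    have : (0 : ℝ) < Q := lt_of_lt_of_le (by positivity) hQ
    exact_mod_cast this
  have : Nonempty (Fin Q) := ⟨⟨0, hQ0⟩⟩
  set F := ∑ i, w i with hF
  have hWF : ∑ i, (v i : ℝ) ^ 2 ≤ 4 * F := by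
    rw [hF, Finset.mul_sum]
    exact Finset.sum_le_sum fun i _ => hvw i
  have hF0 : 0 < F := by linarith
  have hN0 : 0 < N := lt_of_lt_of_le (by positivity) hN
  have hw0 : ∀ i, v i = 0 → w i = 0 := fun i hi => by
    have := hwv i
    rw [hi] at this
    exact le_antisymm (by simpa using this) (hw i)
  have hp : ∀ i, 0 < v i → 0 < unifProb (fun u : Fin Q => T ≤ tailScale u * v i) ∧
      1 / unifProb (fun u : Fin Q => T ≤ tailScale u * v i) - 1 ≤ 8 * T ^ 2 / (v i : ℝ) ^ 2 := by
    intro i hi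
    refine unifProb_le_tailScale_mul hT hi (le_trans ?_ hQ)
    have h1 : T / v i ≤ T := div_le_self hT.le (by exact_mod_cast hi)
    have h2 : 0 ≤ T / v i := by positivity
    nlinarith [sq_nonneg (T - 1)]
  have hvar := expect_horvitzThompson_sub_sq_le (fun i (u : Fin Q) => T ≤ tailScale u * v i) w
    fun i => (Nat.eq_zero_or_pos (v i)).imp (hw0 i) fun h => (hp i h).1
  have hbound : ∑ i, w i ^ 2 * (1 / unifProb (fun u : Fin Q => T ≤ tailScale u * v i) - 1) ≤
      (ε / 4 * F) ^ 2 / 50 := by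
    have h1 : ∀ i, w i ^ 2 * (1 / unifProb (fun u : Fin Q => T ≤ tailScale u * v i) - 1) ≤
        8 * T ^ 2 * B * w i := by
      intro i
      rcases Nat.eq_zero_or_pos (v i) with h | h
      · simp [hw0 i h]
      · have hv' : (0 : ℝ) < (v i : ℝ) ^ 2 := by positivity
        calc _ ≤ w i ^ 2 * (8 * T ^ 2 / (v i : ℝ) ^ 2) :=
              mul_le_mul_of_nonneg_left (hp i h).2 (sq_nonneg _)
          _ = 8 * T ^ 2 * w i * (w i / (v i : ℝ) ^ 2) := by ring
          _ ≤ 8 * T ^ 2 * w i * B := by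
              have := hw i
              gcongr
              rw [div_le_iff₀ hv']
              exact hwv i
          _ = _ := by ring
    refine (Finset.sum_le_sum fun i _ => h1 i).trans ?_
    rw [← Finset.mul_sum, ← hF]
    have h2 : T ^ 2 * N ≤ 8 * F := by
      rw [le_div_iff₀ hN0] at hTW
      linarith
    have h3 : 51200 * B ≤ N * ε ^ 2 := by rwa [div_le_iff₀ (by positivity)] at hN
    have h4 : T ^ 2 * (51200 * B) ≤ 8 * F * ε ^ 2 :=
      calc T ^ 2 * (51200 * B) ≤ T ^ 2 * (N * ε ^ 2) := by gcongr
        _ = T ^ 2 * N * ε ^ 2 := by ring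
        _ ≤ _ := by gcongr
    have h5 : T ^ 2 * (51200 * B) * F ≤ 8 * F * ε ^ 2 * F := by gcongr
    nlinarith
  have ht : 0 < (ε / 4 * F) ^ 2 := by positivity
  refine le_trans (unifProb_mono fun g hg => ?_) <|
    (unifProb_le_expect_div (f := fun g : ι → Fin Q =>
      (horvitzThompson (fun i u => T ≤ tailScale u * v i) w g - F) ^ 2)
      (fun _ => sq_nonneg _) ht).trans ?_
  · rw [← sq_abs (_ - F)]
    gcongr
  · rw [div_le_iff₀ ht]
    linarith

theorem unifProb_scaled_norm (hQ : 0 < Q) {v : ι → ℕ} {H : ℝ} (hH : 50 * (1 + Real.log Q) ≤ H)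
    (hv : 0 < ∑ i, (v i : ℝ) ^ 2) :
    unifProb (fun g : ι → Fin Q => H * ∑ i, (v i : ℝ) ^ 2 ≤
      ∑ i, ((tailScale (g i) : ℝ) * v i) ^ 2) ≤ 1 / 50 := by
  have : Nonempty (Fin Q) := ⟨⟨0, hQ⟩⟩
  have hlog : 0 ≤ Real.log Q := Real.log_natCast_nonneg _
  have hH0 : 0 < H := by linarith
  refine (unifProb_le_expect_div (fun _ => Finset.sum_nonneg fun _ _ => sq_nonneg _)
    (by positivity)).trans ?_
  rw [div_le_iff₀ (by positivity), Finset.expect_sum_comm]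
  calc ∑ i, 𝔼 g : ι → Fin Q, ((tailScale (g i) : ℝ) * v i) ^ 2
      = ∑ i, (𝔼 u : Fin Q, (tailScale u : ℝ) ^ 2) * (v i : ℝ) ^ 2 := by
        refine Finset.sum_congr rfl fun i _ => ?_
        rw [← expect_pi_apply i fun u => (tailScale u : ℝ) ^ 2, Finset.expect_mul]
        simp_rw [mul_pow]
    _ ≤ (1 + Real.log Q) * ∑ i, (v i : ℝ) ^ 2 := by
        rw [← Finset.mul_sum]
        gcongr
        exact expect_tailScale_sq_le hQ
    _ ≤ _ := by nlinarith

/-- The sampling threshold computed from a sketch. -/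
noncomputable def sketchThreshold (N : ℝ) (y : ρ₁ → ℤ) : ℝ :=
  √((∑ r, (y r : ℝ) ^ 2) / Fintype.card ρ₁ / N)

open Classical in
/-- The coordinates that a sketch reports as heavy. -/
noncomputable def heavyCandidates (σ : ρ₂ → ι → Bool) (y : ρ₂ → ℤ) (T : ℝ) : Finset ι :=
  {i | 3 / 4 * T ≤ signEstimate σ (fun r => (y r : ℝ)) i}

/-- The sketch of an integer vector by sign patterns. -/
def signSketch (σ : ρ₁ → ι → Bool) (v : ι → ℤ) (r : ρ₁) : ℤ := ∑ i, boolSign (σ r i) * v i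

/-- If every coordinate is estimated within `T / 4`, the cutoff `3 T / 4` keeps all entries at least
`T` and admits only entries at least `T / 2`. The norm bound leaves room for at most `H W / (T / 2)²
≤ 8 N H` of these. -/
theorem unifProb_heavyCandidates {v : ι → ℕ} {N H T W : ℝ} {K : ℕ} [Nonempty ρ₂] [Nonempty ι]
    (hN : 0 < N) (hH : 0 < H) (hm : 64 * N * H * Real.log (100 * Fintype.card ι) ≤ Fintype.card ρ₂)
    (hK : 8 * N * H ≤ K) (hW : 0 < W) (hT : 0 < T) (hTW : W / (2 * N) ≤ T ^ 2)
    (hv : ∑ i, (v i : ℝ) ^ 2 ≤ H * W) :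
    unifProb (fun σ : ρ₂ → ι → Bool => ¬ (
      (∀ i, T ≤ v i → i ∈ heavyCandidates σ (signSketch σ fun i => v i) T) ∧
      (heavyCandidates σ (signSketch σ fun i => v i) T).card ≤ K)) ≤ 1 / 50 := by
  have hHW : 0 < H * W := by positivity
  have herr := unifProb_signEstimate_error (ρ := ρ₂) (fun i => (v i : ℝ)) (t := T / 4)
    (by positivity) hHW hv
  refine (unifProb_mono fun σ hσ => ?_).trans (herr.trans ?_)
  · by_contra! hlt
    apply hσ
    have hy : (fun r => (signSketch σ (fun i => (v i : ℤ)) r : ℝ)) =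
        fun r => ∑ l, (boolSign (σ r l) : ℝ) * (v l : ℝ) := by
      funext r
      simp [signSketch]
    rw [← hy] at hlt
    refine ⟨fun i hi => ?_, ?_⟩
    · have := (abs_lt.1 (hlt i)).1
      simp only [heavyCandidates, Finset.mem_filter, Finset.mem_univ, true_and]
      linarith
    · set S := heavyCandidates σ (signSketch σ fun i => (v i : ℤ)) T with hS
      have h1 : ∀ i ∈ S, (T / 2) ^ 2 ≤ (v i : ℝ) ^ 2 := by
        intro i hi
        simp only [hS, heavyCandidates, Finset.mem_filter, Finset.mem_univ, true_and] at hi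
        have := (abs_lt.1 (hlt i)).2
        have : T / 2 ≤ v i := by linarith
        gcongr
      have h2 : (S.card : ℝ) * (T / 2) ^ 2 ≤ H * W := by
        rw [← nsmul_eq_mul]
        exact (Finset.card_nsmul_le_sum _ _ _ h1).trans
          ((Finset.sum_le_univ_sum_of_nonneg fun _ => sq_nonneg _).trans hv)
      have h3 : W ≤ T ^ 2 * (2 * N) := by rwa [div_le_iff₀ (by positivity)] at hTW
      have h4 : (S.card : ℝ) ≤ 8 * N * H := by
        have h5 : H * W ≤ H * (T ^ 2 * (2 * N)) := by gcongr
        have hT2 : 0 < (T / 2) ^ 2 := by positivity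
        refine le_of_mul_le_mul_right (a := (T / 2) ^ 2) ?_ hT2
        nlinarith
      exact_mod_cast h4.trans hK
  · set m : ℝ := (Fintype.card ρ₂ : ℝ) with hmd
    have hn : (0 : ℝ) < Fintype.card ι := by exact_mod_cast Fintype.card_pos
    -- With this exponent the union bound over coordinates and both signs of the error sums to `2 n
    -- / (100 n) = 1 / 50`.
    have h1 : Real.log (100 * Fintype.card ι) ≤ m * (T / 4) ^ 2 / (2 * (H * W)) := by
      rw [le_div_iff₀ (by positivity)]
      have h2 : m * (W / (2 * N)) ≤ m * T ^ 2 := by gcongr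
      have h3 : 64 * N * H * Real.log (100 * Fintype.card ι) * (W / (2 * N)) ≤
          m * (W / (2 * N)) := by gcongr
      have h4 : 64 * N * H * Real.log (100 * Fintype.card ι) * (W / (2 * N)) =
          32 * (H * W) * Real.log (100 * Fintype.card ι) := by field_simp; ring
      nlinarith
    calc _ ≤ 2 * Fintype.card ι * Real.exp (-Real.log (100 * Fintype.card ι)) := by gcongr
      _ = 1 / 50 := by
        rw [Real.exp_neg, Real.exp_log (by positivity)]
        field_simp
        norm_num

/-- The three sources of randomness are revealed in turn: `T` depends only on the first sketch, so
the scales are independent of it, and the second sign pattern is independent of the scaled vector.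
Four events of probability at most `1 / 50` are excluded. -/
theorem unifProb_sampling {v : ι → ℕ} {w : ι → ℝ} {B N ε H : ℝ} {K : ℕ} [Nonempty ρ₂]
    [Nonempty ι] (hw : ∀ i, 0 ≤ w i) (hB : 0 < B) (hwv : ∀ i, w i ≤ B * (v i : ℝ) ^ 2)
    (hvw : ∀ i, (v i : ℝ) ^ 2 ≤ 4 * w i) (hε : 0 < ε) (hN1 : 1 ≤ N)
    (hN : 51200 * B / ε ^ 2 ≤ N) (hv : 0 < ∑ i, (v i : ℝ) ^ 2)
    (hQ : 4 * ∑ i, (v i : ℝ) ^ 2 + 2 ≤ Q) (hH : 50 * (1 + Real.log Q) ≤ H)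
    (hρ₁ : 20000 ≤ Fintype.card ρ₁)
    (hm : 64 * N * H * Real.log (100 * Fintype.card ι) ≤ Fintype.card ρ₂) (hK : 8 * N * H ≤ K) :
    unifProb (fun ω : (ρ₁ → ι → Bool) × (ι → Fin Q) × (ρ₂ → ι → Bool) =>
      ¬ (|horvitzThompson (fun i u => sketchThreshold N (signSketch ω.1 fun i => v i) ≤
            tailScale u * v i) w ω.2.1 - ∑ i, w i| ≤ ε / 4 * ∑ i, w i ∧
        (∀ i, sketchThreshold N (signSketch ω.1 fun i => v i) ≤ tailScale (ω.2.1 i) * v i →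
          i ∈ heavyCandidates ω.2.2 (signSketch ω.2.2 fun i => tailScale (ω.2.1 i) * v i)
            (sketchThreshold N (signSketch ω.1 fun i => v i))) ∧
        (heavyCandidates ω.2.2 (signSketch ω.2.2 fun i => tailScale (ω.2.1 i) * v i)
            (sketchThreshold N (signSketch ω.1 fun i => v i))).card ≤ K)) ≤ 1 / 10 := by
  have hQ0 : 0 < Q := by
    have : (0 : ℝ) < Q := lt_of_lt_of_le (by positivity) hQ
    exact_mod_cast this
  have : Nonempty (Fin Q) := ⟨⟨0, hQ0⟩⟩
  have hN0 : 0 < N := by linarith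
  have hH0 : 0 < H := by
    have : 0 ≤ Real.log Q := Real.log_natCast_nonneg _
    linarith
  set W := ∑ i, (v i : ℝ) ^ 2 with hW
  have hρ₁' : (0 : ℝ) < Fintype.card ρ₁ := by
    have : 0 < Fintype.card ρ₁ := by omega
    exact_mod_cast this
  have h1 := unifProb_sign_sketch_norm (ρ := ρ₁) (fun i => (v i : ℝ)) hρ₁ hv
  rw [← hW] at h1
  refine (unifProb_prod_le (δ := 3 / 50) (by norm_num) ?_).trans
    ((add_le_add_left h1 _).trans (by norm_num))
  intro σ₁ hσ₁
  have hT2 : sketchThreshold N (signSketch σ₁ fun i => (v i : ℤ)) ^ 2 =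
      (∑ r, (∑ i, (boolSign (σ₁ r i) : ℝ) * v i) ^ 2) / Fintype.card ρ₁ / N := by
    rw [sketchThreshold, Real.sq_sqrt (by positivity)]
    simp [signSketch]
  set T := sketchThreshold N (signSketch σ₁ fun i => (v i : ℤ)) with hTd
  have hT0 : 0 ≤ T := Real.sqrt_nonneg _
  have hTl : W / (2 * N) ≤ T ^ 2 := by
    rw [hT2, ← div_div]
    exact div_le_div_of_nonneg_right hσ₁.1 hN0.le
  have hTu : T ^ 2 ≤ 2 * W / N := by
    rw [hT2]
    gcongr
    exact hσ₁.2
  have hT : 0 < T := by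
    have : 0 < T ^ 2 := lt_of_lt_of_le (by positivity) hTl
    exact lt_of_le_of_ne hT0 fun h => by rw [← h] at this; simp at this
  have hTQ : 2 * T ^ 2 + 2 ≤ Q := by
    have : 2 * W / N ≤ 2 * W := div_le_self (by positivity) hN1
    linarith
  have h2 := unifProb_horvitzThompson_error (Q := Q) hw hB hwv hvw hε hN hv hT hTu hTQ
  have h3 := unifProb_scaled_norm hQ0 hH hv
  refine (unifProb_prod_le (δ := 1 / 50) (good := fun g : ι → Fin Q =>
    ¬ (ε / 4 * ∑ i, w i ≤
      |horvitzThompson (fun i u => T ≤ tailScale u * v i) w g - ∑ i, w i| ∨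
      H * ∑ i, (v i : ℝ) ^ 2 ≤ ∑ i, ((tailScale (g i) : ℝ) * v i) ^ 2)) (by norm_num) ?_).trans ?_
  · intro g hg
    push Not at hg
    have h4 := unifProb_heavyCandidates (ρ₂ := ρ₂) (v := fun i => tailScale (g i) * v i) hN0 hH0 hm
      hK hv hT hTl (by simpa using hg.2.le)
    refine (unifProb_mono fun σ hσ => ?_).trans h4
    contrapose! hσ
    refine ⟨hg.1.le, ?_, ?_⟩
    · simpa using hσ.1
    · simpa using hσ.2
  · simp only [not_not]
    have := unifProb_or_le (fun g : ι → Fin Q => ε / 4 * ∑ i, w i ≤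
      |horvitzThompson (fun i u => T ≤ tailScale u * v i) w g - ∑ i, w i|)
      (fun g => H * ∑ i, (v i : ℝ) ^ 2 ≤ ∑ i, ((tailScale (g i) : ℝ) * v i) ^ 2)
    linarith

end Analysis

/-! ### The protocol on integer inputs. -/

section Protocol

/-- The matrix known to the coordinator after learning the columns listed by `q`; all other
columns are set to zero. -/
noncomputable def reconstruct {σ ι κ : Type*} (q : κ → ι) (c : σ → κ → ℤ) (j : σ) (i : ι) : ℕ :=
  open Classical in if h : ∃ l, q l = i then (c j h.choose).toNat else 0

theorem reconstruct_of_mem {σ ι κ : Type*} {q : κ → ι} {i : ι} (h : i ∈ Set.range q)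
    (a : σ → ι → ℕ) (j : σ) : reconstruct q (fun j l => (a j (q l) : ℤ)) j i = a j i := by
  have h' : ∃ l, q l = i := h
  simp only [reconstruct, dif_pos h', Int.toNat_natCast]
  rw [h'.choose_spec]

theorem reconstruct_of_notMem {σ ι κ : Type*} {q : κ → ι} {i : ι} (h : i ∉ Set.range q)
    (c : σ → κ → ℤ) (j : σ) : reconstruct q c j i = 0 := by
  have h' : ¬ ∃ l, q l = i := h
  simp [reconstruct, dif_neg h']

theorem exists_subset_range {ι : Type*} [Nonempty ι] (S : Finset ι) {K : ℕ} (h : S.card ≤ K) :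
    ∃ q : Fin K → ι, (S : Set ι) ⊆ Set.range q := by
  have h1 : Fintype.card S ≤ Fintype.card (Fin K) := by simpa using h
  obtain ⟨e⟩ := Function.Embedding.nonempty_of_card_le h1
  obtain ⟨x⟩ := ‹Nonempty ι›
  refine ⟨Function.extend e (fun i => (i : ι)) fun _ => x, fun i hi => ?_⟩
  exact ⟨e ⟨i, hi⟩, e.injective.extend_apply _ _ _⟩

/-- A list of length `K` that contains `S`, whenever `S` has at most `K` elements. -/
noncomputable def listCover {ι : Type*} [Nonempty ι] (S : Finset ι) (K : ℕ) : Fin K → ι :=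
  open Classical in
  if h : S.card ≤ K then (exists_subset_range S h).choose else fun _ => Classical.arbitrary ι

theorem subset_range_listCover {ι : Type*} [Nonempty ι] {S : Finset ι} {K : ℕ}
    (h : S.card ≤ K) : (S : Set ι) ⊆ Set.range (listCover S K) := by
  simp only [listCover, dif_pos h]
  exact (exists_subset_range S h).choose_spec

variable {s n Q : ℕ}

/-- The sum over the servers of the rounded powers of the entries in column `i`. -/
noncomputable def columnWeight (k : ℝ) (a : Fin s → Fin n → ℕ) (i : Fin n) : ℕ :=
  ∑ j, ceilPow (k / 2) (a j i)

/-- The `k`-th power of the sum of column `i`. -/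
noncomputable def columnPower (k : ℝ) (a : Fin s → Fin n → ℕ) (i : Fin n) : ℝ :=
  (∑ j, (a j i : ℝ)) ^ k

/-- The estimate of the `k`-th frequency moment of `a` by sampling above the threshold `T`. -/
noncomputable def momentEstimate (k T : ℝ) (a : Fin s → Fin n → ℕ) (g : Fin n → Fin Q) : ℝ :=
  horvitzThompson (fun i (u : Fin Q) => T ≤ tailScale u * columnWeight k a i) (columnPower k a) g

theorem columnPower_eq_zero {k : ℝ} (hk : k ≠ 0) {a : Fin s → Fin n → ℕ} {i : Fin n}
    (h : ∀ j, a j i = 0) : columnPower k a i = 0 := by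
  simp [columnPower, h, Real.zero_rpow hk]

/-- A column missing from the list is not sampled for `a`, and its reconstruction is zero, so it
contributes nothing to either side. -/
theorem momentEstimate_reconstruct {k T : ℝ} (hk : k ≠ 0) {K : ℕ} (a : Fin s → Fin n → ℕ)
    (g : Fin n → Fin Q) (q : Fin K → Fin n)
    (hq : ∀ i, T ≤ tailScale (g i) * columnWeight k a i → i ∈ Set.range q) :
    momentEstimate k T (reconstruct q fun j l => (a j (q l) : ℤ)) g = momentEstimate k T a g := by
  unfold momentEstimate horvitzThompson
  refine Finset.sum_congr rfl fun i _ => ?_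
  by_cases hi : i ∈ Set.range q
  · have h1 : columnWeight k (reconstruct q fun j l => (a j (q l) : ℤ)) i = columnWeight k a i :=
      Finset.sum_congr rfl fun j _ => by rw [reconstruct_of_mem hi]
    have h2 : columnPower k (reconstruct q fun j l => (a j (q l) : ℤ)) i = columnPower k a i := by
      simp only [columnPower, reconstruct_of_mem hi]
    simp only [h1, h2]
  · rw [columnPower_eq_zero hk fun j => reconstruct_of_notMem hi _ j,
      Set.indicator_of_notMem (s := {x | T ≤ tailScale x * columnWeight k a i})
        (fun h => hi (hq i h))]
    simp

theorem abs_signSketch_le {ρ : Type*} [Fintype ρ] (σ : ρ → Fin n → Bool) {v : Fin n → ℕ} {B : ℕ}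
    (hv : ∀ i, v i ≤ B) (r : ρ) : |signSketch σ (fun i => (v i : ℤ)) r| ≤ (n * B : ℕ) := by
  refine (Finset.abs_sum_le_sum_abs _ _).trans ?_
  refine (Finset.sum_le_card_nsmul _ _ (B : ℤ) fun i _ => ?_).trans (by simp)
  rw [abs_mul, abs_boolSign, one_mul, Nat.abs_cast]
  exact_mod_cast hv i

theorem sum_signSketch {ρ : Type*} [Fintype ρ] (σ : ρ → Fin n → Bool) (v : Fin s → Fin n → ℤ)
    (r : ρ) : ∑ j, signSketch σ (v j) r = signSketch σ (fun i => ∑ j, v j i) r := by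
  unfold signSketch
  rw [Finset.sum_comm]
  simp_rw [Finset.mul_sum]

/-- The protocol for quantized inputs. -/
theorem exists_protocol_of_quantizer {X : Type} {k : ℝ} (hk : 2 < k) (hs : 0 < s) (hn : 0 < n)
    {N ε H c : ℝ} {b A m K V : ℕ} (f : X → Fin n → ℕ) (hf : ∀ x i, f x i ≤ A)
    (hV : ∀ a ≤ A, ceilPow (k / 2) a ≤ V) (hnb : n * (Q * V) ≤ 2 ^ b) (hAb : A ≤ 2 ^ b)
    (hnb' : n ≤ 2 ^ b) (hε : 0 < ε) (hN1 : 1 ≤ N) (hN : 51200 * (s : ℝ) ^ (k - 2) / ε ^ 2 ≤ N)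
    (hQ : 4 * (n * (s * V) ^ 2) + 2 ≤ Q) (hH : 50 * (1 + Real.log Q) ≤ H)
    (hm : 64 * N * H * Real.log (100 * n) ≤ m) (hm0 : 0 < m) (hK : 8 * N * H ≤ K) :
    ∃ P : TwoRoundProtocol s X,
      P.totalBits = s * ((b + 2) * (20000 + m + K + K)) ∧
      ∀ x : Fin s → X, 9 / 10 ≤ P.μ.real {ω | ∃ e : ℝ, P.run x ω = c * e ∧
        |e - ∑ i, columnPower k (fun j => f (x j)) i| ≤
          ε / 4 * ∑ i, columnPower k (fun j => f (x j)) i} := by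
  have : Nonempty (Fin n) := ⟨⟨0, hn⟩⟩
  have hQ0 : 0 < Q := by omega
  have : Nonempty (Fin Q) := ⟨⟨0, hQ0⟩⟩
  have : Nonempty (Fin m) := ⟨⟨0, hm0⟩⟩
  let Ω := (Fin 20000 → Fin n → Bool) × (Fin n → Fin Q) × (Fin m → Fin n → Bool)
  let thr : (Fin s → Fin 20000 ⊕ Fin m → ℤ) → ℝ := fun y =>
    sketchThreshold N fun r => ∑ j, y j (Sum.inl r)
  let lst : Ω → (Fin s → Fin 20000 ⊕ Fin m → ℤ) → Fin K → Fin n := fun ω y =>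
    listCover (heavyCandidates ω.2.2 (fun r => ∑ j, y j (Sum.inr r)) (thr y)) K
  let up₁ : Ω → X → Fin 20000 ⊕ Fin m → ℤ := fun ω x => Sum.elim
    (signSketch ω.1 fun i => (ceilPow (k / 2) (f x i) : ℕ))
    (signSketch ω.2.2 fun i => (tailScale (ω.2.1 i) * ceilPow (k / 2) (f x i) : ℕ))
  let up₂ : Ω → X → (Fin K → Fin n) → Fin K → ℤ := fun _ x q l => f x (q l)
  let out : Ω → (Fin s → Fin 20000 ⊕ Fin m → ℤ) → (Fin s → Fin K → ℤ) → ℝ := fun ω y₁ y₂ =>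
    c * momentEstimate k (thr y₁) (reconstruct (lst ω y₁) y₂) ω.2.1
  have hup₁ : ∀ ω x i, |up₁ ω x i| ≤ 2 ^ b := by
    rintro ω x (r | r)
    · refine (abs_signSketch_le ω.1 (B := Q * V) (fun i => ?_) r).trans (by exact_mod_cast hnb)
      exact (hV _ (hf x i)).trans (Nat.le_mul_of_pos_left _ hQ0)
    · refine (abs_signSketch_le ω.2.2 (B := Q * V) (fun i => ?_) r).trans (by exact_mod_cast hnb)
      exact Nat.mul_le_mul (tailScale_le _) (hV _ (hf x i))
  have hup₂ : ∀ ω x q i, |up₂ ω x q i| ≤ 2 ^ b := by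
    intro ω x q i
    simp only [up₂, Nat.abs_cast]
    exact_mod_cast (hf x _).trans hAb
  obtain ⟨P, hP, hrun⟩ := exists_twoRoundProtocol (s := s) hn hnb' up₁ lst up₂ out hup₁ hup₂
  refine ⟨P, by simpa [add_assoc] using hP, fun x => ?_⟩
  set a : Fin s → Fin n → ℕ := fun j => f (x j) with ha
  have hmu := hrun x {y | ∃ e : ℝ, y = c * e ∧
    |e - ∑ i, columnPower k a i| ≤ ε / 4 * ∑ i, columnPower k a i}
  simp only [Set.mem_ofPred_eq] at hmu
  rw [hmu]
  have hw : ∀ i, 0 ≤ columnPower k a i := fun i =>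
    Real.rpow_nonneg (Finset.sum_nonneg fun _ _ => Nat.cast_nonneg _) _
  have hthr : ∀ ω : Ω, thr (fun j => up₁ ω (x j)) =
      sketchThreshold N (signSketch ω.1 fun i => (columnWeight k a i : ℤ)) := by
    intro ω
    simp only [thr, up₁, Sum.elim_inl, columnWeight, Nat.cast_sum, ha, sum_signSketch]
  have hcand : ∀ ω : Ω, (fun r => ∑ j, up₁ ω (x j) (Sum.inr r)) =
      signSketch ω.2.2 fun i => tailScale (ω.2.1 i) * (columnWeight k a i : ℤ) := by
    intro ω
    simp only [up₁, Sum.elim_inr, columnWeight, Nat.cast_sum, Nat.cast_mul, ha, sum_signSketch,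
      Finset.mul_sum]
  have hout : ∀ ω : Ω, out ω (fun j => up₁ ω (x j))
      (fun j => up₂ ω (x j) (lst ω fun i => up₁ ω (x i))) =
      c * momentEstimate k (thr fun j => up₁ ω (x j)) (reconstruct (lst ω fun j => up₁ ω (x j))
        fun j l => (a j (lst ω (fun j => up₁ ω (x j)) l) : ℤ)) ω.2.1 := fun ω => rfl
  simp_rw [hout]
  have hvw : ∀ i, (columnWeight k a i : ℝ) ^ 2 ≤ 4 * columnPower k a i := fun i => by
    have := ceilPow_sq_le_rpow_sum hk fun j => a j i
    simpa [columnWeight, columnPower] using this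
  have hwv : ∀ i, columnPower k a i ≤ (s : ℝ) ^ (k - 2) * (columnWeight k a i : ℝ) ^ 2 :=
    fun i => by
    have := rpow_sum_le_mul_ceilPow_sq hk fun j => a j i
    simpa [columnWeight, columnPower] using this
  have hnonneg : 0 ≤ ∑ i, (columnWeight k a i : ℝ) ^ 2 := Finset.sum_nonneg fun _ _ => sq_nonneg _
  have hnot := unifProb_not fun ω : Ω => ∃ e : ℝ,
    c * momentEstimate k (thr fun j => up₁ ω (x j)) (reconstruct (lst ω fun j => up₁ ω (x j))
        fun j l => (a j (lst ω (fun j => up₁ ω (x j)) l) : ℤ)) ω.2.1 = c * e ∧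
    |e - ∑ i, columnPower k a i| ≤ ε / 4 * ∑ i, columnPower k a i
  -- The sampling analysis needs a positive norm; for the zero matrix every reconstruction is zero
  -- and the estimate is exact.
  rcases hnonneg.eq_or_lt with h0 | hpos
  · have hv0 : ∀ i, columnWeight k a i = 0 := fun i => by
      have := (Finset.sum_eq_zero_iff_of_nonneg fun i _ =>
        sq_nonneg (columnWeight k a i : ℝ)).1 h0.symm i (Finset.mem_univ i)
      simpa using this
    have hw0 : ∀ i, columnPower k a i = 0 := fun i => by
      refine le_antisymm ?_ (hw i)
      have := hwv i
      simpa [hv0 i] using this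
    have ha0 : ∀ j i, a j i = 0 := by
      intro j i
      have h1 := hw0 i
      have hsum : (0 : ℝ) ≤ ∑ j, (a j i : ℝ) := Finset.sum_nonneg fun _ _ => Nat.cast_nonneg _
      rw [columnPower, Real.rpow_eq_zero hsum (by linarith)] at h1
      have := (Finset.sum_eq_zero_iff_of_nonneg fun j _ => Nat.cast_nonneg (a j i)).1 h1 j
        (Finset.mem_univ j)
      exact_mod_cast this
    have hbad : unifProb (fun ω : Ω => ¬ ∃ e : ℝ,
        c * momentEstimate k (thr fun j => up₁ ω (x j)) (reconstruct (lst ω fun j => up₁ ω (x j))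
          fun j l => (a j (lst ω (fun j => up₁ ω (x j)) l) : ℤ)) ω.2.1 = c * e ∧
        |e - ∑ i, columnPower k a i| ≤ ε / 4 * ∑ i, columnPower k a i) ≤ 0 := by
      refine (unifProb_mono (q := fun _ => False) fun ω hω => hω ⟨_, rfl, ?_⟩).trans
        (by simp [unifProb])
      have h2 : ∀ i, columnPower k (reconstruct (lst ω fun j => up₁ ω (x j))
          fun j l => (a j (lst ω (fun j => up₁ ω (x j)) l) : ℤ)) i = 0 := by
        intro i
        refine columnPower_eq_zero (by linarith) fun j => ?_
        by_cases hi : i ∈ Set.range (lst ω fun j => up₁ ω (x j))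
        · rw [reconstruct_of_mem hi, ha0]
        · rw [reconstruct_of_notMem hi]
      simp [momentEstimate, horvitzThompson, h2, hw0]
    linarith
  · have hcw : ∀ i, columnWeight k a i ≤ s * V := fun i => by
      refine (Finset.sum_le_card_nsmul _ _ V fun j _ => hV _ (hf _ _)).trans (by simp)
    have hQW : 4 * ∑ i, (columnWeight k a i : ℝ) ^ 2 + 2 ≤ Q := by
      have h1 : ∑ i, columnWeight k a i ^ 2 ≤ n * (s * V) ^ 2 :=
        (Finset.sum_le_card_nsmul _ _ _ fun i _ => Nat.pow_le_pow_left (hcw i) 2).trans (by simp)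
      have h2 : 4 * ∑ i, columnWeight k a i ^ 2 + 2 ≤ Q := by omega
      exact_mod_cast h2
    have hmain := unifProb_sampling (ρ₁ := Fin 20000) (ρ₂ := Fin m) (Q := Q) hw
      (Real.rpow_pos_of_pos (by exact_mod_cast hs) _) hwv hvw hε hN1 hN hpos hQW hH (by simp)
      (by simpa using hm) hK
    have hbad := (unifProb_mono (p := fun ω : Ω => ¬ ∃ e : ℝ,
        c * momentEstimate k (thr fun j => up₁ ω (x j)) (reconstruct (lst ω fun j => up₁ ω (x j))
          fun j l => (a j (lst ω (fun j => up₁ ω (x j)) l) : ℤ)) ω.2.1 = c * e ∧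
        |e - ∑ i, columnPower k a i| ≤ ε / 4 * ∑ i, columnPower k a i)
        fun ω hω => ?_).trans hmain
    · linarith
    · contrapose! hω
      obtain ⟨h1, h2, h3⟩ := hω
      refine ⟨_, rfl, ?_⟩
      rw [momentEstimate_reconstruct (by linarith), hthr]
      · exact h1
      · intro i hi
        rw [hthr] at hi
        simp only [lst, hcand, hthr]
        exact subset_range_listCover h3 (h2 i hi)

end Protocol

/-! ### Rounding real inputs and counting bits. -/

section Quantization

/-- Rounding down to multiples of `d`, with at most `A + 1` levels. -/
noncomputable def quantize (d : ℝ) (A : ℕ) (y : ℝ) : ℕ := min A ⌊y / d⌋₊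

theorem quantize_bounds {d η M y : ℝ} {A : ℕ} (hd : 0 < d) (hM : 1 ≤ M) (hη : d = η * M⁻¹)
    (hA : M / d ≤ A) (hy : y = 0 ∨ (M⁻¹ ≤ y ∧ y ≤ M)) :
    (1 - η) * y ≤ d * quantize d A y ∧ d * quantize d A y ≤ y := by
  rcases hy with rfl | ⟨h1, h2⟩
  · simp [quantize]
  · have hy0 : 0 ≤ y := (by positivity : 0 ≤ M⁻¹).trans h1
    have hη0 : 0 ≤ η := by
      by_contra! hneg
      have : η * M⁻¹ ≤ 0 := mul_nonpos_of_nonpos_of_nonneg hneg.le (by positivity)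
      linarith
    -- The cap `A` is inactive on admissible entries; it only keeps messages bounded on other
    -- inputs.
    have h3 : ⌊y / d⌋₊ ≤ A := Nat.floor_le_of_le ((div_le_div_of_nonneg_right h2 hd.le).trans hA)
    rw [quantize, min_eq_right h3]
    have h4 : y / d < ⌊y / d⌋₊ + 1 := Nat.lt_floor_add_one _
    have h5 : (⌊y / d⌋₊ : ℝ) ≤ y / d := Nat.floor_le (by positivity)
    rw [div_lt_iff₀ hd] at h4
    rw [le_div_iff₀ hd] at h5
    have h6 : d ≤ η * y := by rw [hη]; gcongr
    constructor <;> linarith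

theorem quantize_moment_bounds {s n : ℕ} {k ε M d : ℝ} {A : ℕ} (hk : 2 < k) (hε : 0 < ε)
    (hε1 : ε < 1) (hM : 1 ≤ M) (hd : d = ε / (4 * k * M)) (hA : M / d ≤ A)
    (x : Fin s → Fin n → ℝ) (hx : ∀ j i, x j i = 0 ∨ (M⁻¹ ≤ x j i ∧ x j i ≤ M)) :
    (1 - ε / 4) * frequencyMoment k x ≤
      d ^ k * ∑ i, columnPower k (fun j i => quantize d A (x j i)) i ∧
    d ^ k * ∑ i, columnPower k (fun j i => quantize d A (x j i)) i ≤ frequencyMoment k x := by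
  have hd0 : 0 < d := by rw [hd]; positivity
  have hη : d = ε / (4 * k) * M⁻¹ := by rw [hd]; field_simp
  have hη1 : ε / (4 * k) ≤ 1 := by rw [div_le_one (by positivity)]; linarith
  have hx0 : ∀ i, 0 ≤ ∑ j, x j i := fun i => Finset.sum_nonneg fun j _ => by
    rcases hx j i with h | ⟨h, -⟩
    · exact h.ge
    · exact (by positivity : 0 ≤ M⁻¹).trans h
  have hq := fun j i => quantize_bounds hd0 hM hη hA (hx j i)
  have hpow : ∀ i, d ^ k * columnPower k (fun j i => quantize d A (x j i)) i =
      (∑ j, d * (quantize d A (x j i) : ℝ)) ^ k := fun i => by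
    rw [columnPower, ← Finset.mul_sum,
      Real.mul_rpow hd0.le (Finset.sum_nonneg fun _ _ => Nat.cast_nonneg _)]
  -- Bernoulli's inequality turns a relative entry error `ε / (4k)` into a relative moment error `ε
  -- / 4`.
  have hbern : 1 - ε / 4 ≤ (1 - ε / (4 * k)) ^ k := by
    have := one_add_mul_self_le_rpow_one_add (s := -(ε / (4 * k))) (by linarith)
      (by linarith : (1 : ℝ) ≤ k)
    have h2 : k * (ε / (4 * k)) = ε / 4 := by field_simp
    rw [mul_neg, h2] at this
    simpa [sub_eq_add_neg] using this
  rw [frequencyMoment, Finset.mul_sum, Finset.mul_sum]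
  simp_rw [hpow]
  constructor
  · refine Finset.sum_le_sum fun i _ => ?_
    calc (1 - ε / 4) * (∑ j, x j i) ^ k ≤ (1 - ε / (4 * k)) ^ k * (∑ j, x j i) ^ k := by
          have := Real.rpow_nonneg (hx0 i) k
          gcongr
      _ = (∑ j, (1 - ε / (4 * k)) * x j i) ^ k := by
          rw [← Finset.mul_sum, Real.mul_rpow (by linarith) (hx0 i)]
      _ ≤ _ := by
          refine Real.rpow_le_rpow ?_ (Finset.sum_le_sum fun j _ => (hq j i).1) (by linarith)
          rw [← Finset.mul_sum]
          exact mul_nonneg (by linarith) (hx0 i)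
  · refine Finset.sum_le_sum fun i _ => ?_
    exact Real.rpow_le_rpow (Finset.sum_nonneg fun _ _ => by positivity)
      (Finset.sum_le_sum fun j _ => (hq j i).2) (by linarith)

theorem exists_nat_bits {p : ℝ} (hp : 2 ≤ p) :
    ∃ l : ℕ, 1 ≤ l ∧ p ≤ 2 ^ l ∧ (l : ℝ) ≤ 4 * Real.log p := by
  have h2 : 1 / 2 < Real.log 2 := by have := Real.log_two_gt_d9; linarith
  have h3 : Real.log 2 ≤ Real.log p := Real.log_le_log two_pos hp
  have h4 : 0 < Real.logb 2 p := Real.logb_pos one_lt_two (by linarith)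
  refine ⟨⌈Real.logb 2 p⌉₊, Nat.ceil_pos.2 h4, ?_, ?_⟩
  · rw [← Real.rpow_natCast, ← Real.logb_le_iff_le_rpow one_lt_two (by linarith)]
    exact Nat.le_ceil _
  · have h5 := Nat.ceil_lt_add_one h4.le
    have h6 : Real.logb 2 p ≤ 2 * Real.log p := by
      rw [Real.logb, div_le_iff₀ (by linarith)]
      nlinarith
    linarith

/-- The cube of the logarithm has one factor from the word length `b`, one from the norm growth `H`,
and one from the union bound over coordinates in `m`. -/
theorem total_bits_le {s l b m K q e : ℕ} {N H L : ℝ} (hb : b = (1 + q + e) * l)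
    (hl : (1 : ℝ) ≤ l) (hN : 1 ≤ N) (hH : H = 50 * (1 + q * l)) (hm : m = ⌈512 * N * H * l⌉₊)
    (hK : K = ⌈8 * N * H⌉₊) (hL : (l : ℝ) ≤ 4 * L) :
    ((s * ((b + 2) * (20000 + m + K + K)) : ℕ) : ℝ) ≤
      (3 + q + e) * (20003 + 528 * (50 * (1 + q))) * (s * N) * (64 * L ^ 3) := by
  have hN0 : 0 < N := by linarith
  have hq0 : (0 : ℝ) ≤ q := Nat.cast_nonneg _
  have he0 : (0 : ℝ) ≤ e := Nat.cast_nonneg _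
  have hH0 : 0 < H := by rw [hH]; positivity
  have hbl : (b : ℝ) + 2 ≤ (3 + q + e) * l := by
    rw [hb]
    push_cast
    linarith
  have hHl : H ≤ 50 * (1 + q) * l := by
    rw [hH]
    linarith
  have hm1 : (m : ℝ) ≤ 512 * (N * H * l) + 1 := by
    rw [hm, ← mul_assoc, ← mul_assoc]
    exact (Nat.ceil_lt_add_one (by positivity)).le
  have hK1 : (K : ℝ) ≤ 8 * (N * H) + 1 := by
    rw [hK, ← mul_assoc]
    exact (Nat.ceil_lt_add_one (by positivity)).le
  have hsum : 20000 + (m : ℝ) + K + K ≤ (20003 + 528 * (50 * (1 + q))) * (N * l ^ 2) := by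
    have hNl : 1 ≤ N * (l : ℝ) ^ 2 := one_le_mul_of_one_le_of_one_le hN (one_le_pow₀ hl)
    have h1 : N * H * l ≤ 50 * (1 + q) * (N * l ^ 2) :=
      calc N * H * l ≤ N * (50 * (1 + q) * l) * l := by gcongr
        _ = _ := by ring
    have h2 : N * H ≤ N * H * l := le_mul_of_one_le_right (by positivity) hl
    linarith
  have hL3 : (l : ℝ) ^ 3 ≤ 64 * L ^ 3 := by
    have := pow_le_pow_left₀ (by positivity) hL 3
    rw [mul_pow] at this
    linarith
  push_cast
  calc (s : ℝ) * ((b + 2) * (20000 + m + K + K))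
      ≤ s * (((3 + q + e) * l) * ((20003 + 528 * (50 * (1 + q))) * (N * l ^ 2))) := by gcongr
    _ = (3 + q + e) * (20003 + 528 * (50 * (1 + q))) * (s * N) * l ^ 3 := by ring
    _ ≤ (3 + q + e) * (20003 + 528 * (50 * (1 + q))) * (s * N) * (64 * L ^ 3) := by gcongr

theorem approx_of_approx {F G y D ε : ℝ} (hε : 0 < ε) (hε1 : ε < 1) (hD : 0 < D) (hG : 0 ≤ G)
    (h1 : (1 - ε / 4) * F ≤ D * G) (h2 : D * G ≤ F) (hy : |y - G| ≤ ε / 4 * G) :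
    (1 - ε) * F ≤ D * y ∧ D * y ≤ (1 + ε) * F := by
  have hF0 : 0 ≤ F := (mul_nonneg hD.le hG).trans h2
  obtain ⟨h3, h4⟩ := abs_le.1 hy
  have h5 : D * ((1 - ε / 4) * G) ≤ D * y := by gcongr; linarith
  have h6 : D * y ≤ D * ((1 + ε / 4) * G) := by gcongr; linarith
  have hεF : 0 ≤ ε * F := by positivity
  have hεF' : 0 ≤ ε ^ 2 * F := by positivity
  constructor
  · have h7 : (1 - ε / 4) * ((1 - ε / 4) * F) ≤ (1 - ε / 4) * (D * G) :=
      mul_le_mul_of_nonneg_left h1 (by linarith)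
    linarith
  · have h7 : (1 + ε / 4) * (D * G) ≤ (1 + ε / 4) * F :=
      mul_le_mul_of_nonneg_left h2 (by linarith)
    linarith

end Quantization

/-! ### Choice of parameters. -/

theorem mainTheorem2 (k : ℝ) (hk : 2 < k) :
    ∃ (C : ℝ) (c : ℕ), ∀ (s n : ℕ) (ε M : ℝ), 1 ≤ s → 1 ≤ n → 0 < ε → ε < 1 → 1 ≤ M →
      ∃ P : TwoRoundProtocol s (Fin n → ℝ),
        (P.totalBits : ℝ) ≤
          C * ((s : ℝ) ^ (k - 1) / ε ^ 2) * Real.log (2 + n * s * M / ε) ^ c ∧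
        ∀ x : Fin s → Fin n → ℝ,
          (∀ j i, x j i = 0 ∨ (M⁻¹ ≤ x j i ∧ x j i ≤ M)) →
          9 / 10 ≤ P.μ.real {ω | (1 - ε) * frequencyMoment k x ≤ P.run x ω ∧
            P.run x ω ≤ (1 + ε) * frequencyMoment k x} := by
  obtain ⟨κ, hκ⟩ : ∃ κ : ℕ, k ≤ κ := exists_nat_ge k
  have hκ1 : 1 ≤ κ := by
    have : (0 : ℝ) < κ := by linarith
    exact_mod_cast this
  have hkκ : k ≤ 2 ^ κ := hκ.trans (by exact_mod_cast Nat.lt_two_pow_self.le)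
  -- Every size is bounded by a power of `2 ^ l`, which exceeds `n`, `s`, `M` and `ε⁻¹`. In `M / d =
  -- 4 k M² / ε` the factors cost exponents 2, `κ`, 2 and 1, giving `A`; then `V = A ^ κ` has
  -- exponent `e`, and `8 n (s V)²` has exponent `3 + 1 + 2 + 2 e = q`.
  obtain ⟨e, he⟩ : ∃ e : ℕ, e = (5 + κ) * κ := ⟨_, rfl⟩
  obtain ⟨q, hq⟩ : ∃ q : ℕ, q = 6 + 2 * e := ⟨_, rfl⟩
  refine ⟨(3 + q + e) * (20003 + 528 * (50 * (1 + q))) * 51200 * 64, 3,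
    fun s n ε M hs hn hε hε1 hM => ?_⟩
  have hs' : (1 : ℝ) ≤ s := by exact_mod_cast hs
  have hn' : (1 : ℝ) ≤ n := by exact_mod_cast hn
  have hε' : 1 ≤ ε⁻¹ := (one_le_inv₀ hε).2 hε1.le
  have hprod : (n : ℝ) * s * M / ε = n * s * M * ε⁻¹ := div_eq_mul_inv _ _
  have hns : (1 : ℝ) ≤ n * s := one_le_mul_of_one_le_of_one_le hn' hs'
  have hnsM : (1 : ℝ) ≤ n * s * M := one_le_mul_of_one_le_of_one_le hns hM
  have hp1 : (1 : ℝ) ≤ n * s * M / ε := by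
    rw [hprod]; exact one_le_mul_of_one_le_of_one_le hnsM hε'
  obtain ⟨l, hl1, hpl, hll⟩ := exists_nat_bits (p := 2 + n * s * M / ε) (by linarith)
  set L := Real.log (2 + n * s * M / ε) with hL
  have hle : n * s * M * ε⁻¹ ≤ (2 : ℝ) ^ l := by rw [← hprod]; linarith
  have hnsl : (n : ℝ) * s * M ≤ 2 ^ l := (le_mul_of_one_le_right (by linarith) hε').trans hle
  have hεl : ε⁻¹ ≤ (2 : ℝ) ^ l := (le_mul_of_one_le_left (by linarith) hnsM).trans hle
  have hMl : M ≤ (2 : ℝ) ^ l := (le_mul_of_one_le_left (by linarith) hns).trans hnsl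
  have hnsl' : (n : ℝ) * s ≤ 2 ^ l := (le_mul_of_one_le_right (by linarith) hM).trans hnsl
  have hnl' : (n : ℝ) ≤ 2 ^ l := (le_mul_of_one_le_right (by linarith) hs').trans hnsl'
  have hsl' : (s : ℝ) ≤ 2 ^ l := (le_mul_of_one_le_left (by linarith) hn').trans hnsl'
  have hnl : n ≤ 2 ^ l := by exact_mod_cast hnl'
  have hsl : s ≤ 2 ^ l := by exact_mod_cast hsl'
  have h2l : 2 ≤ 2 ^ l := by simpa using Nat.pow_le_pow_right two_pos hl1
  obtain ⟨d, hd⟩ : ∃ d : ℝ, d = ε / (4 * k * M) := ⟨_, rfl⟩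
  have hd0 : 0 < d := by rw [hd]; positivity
  obtain ⟨A, hA⟩ : ∃ A : ℕ, A = 2 ^ ((5 + κ) * l) := ⟨_, rfl⟩
  have hA0 : 0 < A := by rw [hA]; positivity
  have hMA : M / d ≤ A := by
    have h1 : M / d = 4 * k * (M * M) * ε⁻¹ := by rw [hd]; field_simp
    have h2 : (4 : ℝ) ≤ 2 ^ l * 2 ^ l := by
      have : (2 : ℝ) ≤ 2 ^ l := by exact_mod_cast h2l
      nlinarith
    have h3 : k ≤ (2 ^ l) ^ κ := hkκ.trans (pow_le_pow_left₀ two_pos.le (by exact_mod_cast h2l) _)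
    calc M / d = 4 * k * (M * M) * ε⁻¹ := h1
      _ ≤ (2 ^ l * 2 ^ l) * (2 ^ l) ^ κ * (2 ^ l * 2 ^ l) * 2 ^ l := by gcongr
      _ = A := by rw [hA]; push_cast; ring
  obtain ⟨V, hV⟩ : ∃ V : ℕ, V = 2 ^ (e * l) := ⟨_, rfl⟩
  have hAV : A ^ κ = V := by rw [hA, hV, he, ← pow_mul]; congr 1; ring
  have hcV : ∀ a ≤ A, ceilPow (k / 2) a ≤ V := fun a ha => by
    rw [← hAV]
    exact ceilPow_le_pow (by linarith) ha hA0 (by linarith)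
  obtain ⟨Q, hQ⟩ : ∃ Q : ℕ, Q = 2 ^ (q * l) := ⟨_, rfl⟩
  have hVQ : 4 * (n * (s * V) ^ 2) + 2 ≤ Q := by
    have hV1 : 1 ≤ V := by rw [hV]; exact Nat.one_le_two_pow
    have h1 : 1 ≤ n * (s * V) ^ 2 := Nat.one_le_iff_ne_zero.2 (by positivity)
    calc 4 * (n * (s * V) ^ 2) + 2 ≤ 2 * 2 * 2 * (n * (s * V) ^ 2) := by omega
      _ ≤ 2 ^ l * 2 ^ l * 2 ^ l * (2 ^ l * (2 ^ l * V) ^ 2) := by gcongr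
      _ = Q := by rw [hQ, hV, hq]; ring
  obtain ⟨b, hb⟩ : ∃ b : ℕ, b = (1 + q + e) * l := ⟨_, rfl⟩
  have hnb : n * (Q * V) ≤ 2 ^ b :=
    calc n * (Q * V) ≤ 2 ^ l * (Q * V) := by gcongr
      _ = 2 ^ b := by rw [hQ, hV, hb]; ring
  have hAb : A ≤ 2 ^ b := by
    rw [hA, hb]
    refine Nat.pow_le_pow_right two_pos (Nat.mul_le_mul_right _ ?_)
    have : 5 + κ ≤ e := by rw [he]; exact Nat.le_mul_of_pos_right _ hκ1
    omega
  have hnb' : n ≤ 2 ^ b := hnl.trans <| Nat.pow_le_pow_right two_pos <| by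
    rw [hb]; exact Nat.le_mul_of_pos_left _ (by omega)
  obtain ⟨N, hN⟩ : ∃ N : ℝ, N = 51200 * (s : ℝ) ^ (k - 2) / ε ^ 2 := ⟨_, rfl⟩
  have hN1 : 1 ≤ N := by
    have h1 : (1 : ℝ) ≤ (s : ℝ) ^ (k - 2) := Real.one_le_rpow hs' (by linarith)
    rw [hN, one_le_div (by positivity)]
    nlinarith
  obtain ⟨H, hH⟩ : ∃ H : ℝ, H = 50 * (1 + q * l) := ⟨_, rfl⟩
  have hH0 : 0 < H := by rw [hH]; positivity
  have hlog2 : Real.log 2 ≤ 1 := by have := Real.log_two_lt_d9; linarith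
  have hHQ : 50 * (1 + Real.log Q) ≤ H := by
    have h1 : Real.log Q = (q * l : ℝ) * Real.log 2 := by
      rw [hQ]; push_cast; rw [Real.log_pow]; push_cast; rfl
    have h2 : (q * l : ℝ) * Real.log 2 ≤ q * l := mul_le_of_le_one_right (by positivity) hlog2
    rw [h1, hH]
    linarith
  have hl1' : (1 : ℝ) ≤ l := by exact_mod_cast hl1
  obtain ⟨m, hm⟩ : ∃ m : ℕ, m = ⌈512 * N * H * l⌉₊ := ⟨_, rfl⟩
  have hmlog : 64 * N * H * Real.log (100 * n) ≤ m := by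
    have h1 : Real.log (100 * n) ≤ 8 * l := by
      -- Since `100 ≤ 2 ^ 7` and `l ≥ 1`, the logarithm is at most `7 + l ≤ 8 l`; hence `512 = 64 *
      -- 8` in `m`.
      have h2 : (100 * n : ℝ) ≤ 2 ^ (7 + l) := by rw [pow_add]; gcongr; norm_num
      have h3 := Real.log_le_log (by positivity) h2
      rw [Real.log_pow] at h3
      refine h3.trans ((mul_le_of_le_one_right (by positivity) hlog2).trans ?_)
      push_cast
      linarith
    calc 64 * N * H * Real.log (100 * n) ≤ 64 * N * H * (8 * l) := by gcongr
      _ = 512 * N * H * l := by ring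
      _ ≤ m := by rw [hm]; exact Nat.le_ceil _
  have hm0 : 0 < m := by rw [hm]; exact Nat.ceil_pos.2 (by positivity)
  obtain ⟨K, hK⟩ : ∃ K : ℕ, K = ⌈8 * N * H⌉₊ := ⟨_, rfl⟩
  obtain ⟨P, hbits, hP⟩ := exists_protocol_of_quantizer (K := K) (c := d ^ k) hk hs hn
    (fun (x : Fin n → ℝ) i => quantize d A (x i)) (fun _ _ => min_le_left _ _) hcV hnb hAb hnb' hε
    hN1 hN.ge hVQ hHQ hmlog hm0 (by rw [hK]; exact Nat.le_ceil _)
  refine ⟨P, ?_, fun x hx => (hP x).trans (measureReal_mono ?_)⟩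
  · have hsk : (s : ℝ) * (s : ℝ) ^ (k - 2) = (s : ℝ) ^ (k - 1) := by
      rw [← Real.rpow_one_add' (by positivity) (by linarith)]
      congr 1
      ring
    have h1 := total_bits_le (s := s) hb hl1' hN1 hH hm hK hll
    rw [← hbits] at h1
    refine h1.trans (le_of_eq ?_)
    rw [hN, ← hsk]
    ring
  · rintro ω ⟨y, hrun, hy⟩
    obtain ⟨h1, h2⟩ := quantize_moment_bounds hk hε hε1 hM hd hMA x hx
    rw [Set.mem_ofPred_eq, hrun]
    exact approx_of_approx hε hε1 (Real.rpow_pos_of_pos hd0 _) (Finset.sum_nonneg fun i _ =>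
      Real.rpow_nonneg (Finset.sum_nonneg fun _ _ => Nat.cast_nonneg _) _) h1 h2 hy
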